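/- **Notation.** Let $d\in\mathbb N$; write $\partial_I$ ($I\in\mathbb N^d$) for multi-index derivatives, $f\star g$ for convolution on $\mathbb R^d$, and $\hat f(\xi)=\int_{\mathbb R^d}f(x)e^{-\mathrm i\,\xi\cdot x}\,dx$. For $\epsilon>0$ let $\mathbb R^d_\epsilon=\{x+\mathrm iy: x,y\in\mathbb R^d,\ \|y\|<\epsilon\}\subseteq\mathbb C^d$. A *convenient analytical setting* consists of a complex linear space $\mathcal C\subseteq C^\infty(\mathbb R^d,\mathbb C)$ of functions (integrable, so that Fourier transforms make sense), a set $\mathcal D\subseteq\mathbb C[\![\partial_1,\dots,\partial_d]\!]$, and a $\mathbb C$-linear action of the operators $D=\sum_I c_I\partial_I\in\mathcal D$ on functions, such that 1. $\mathcal C$ is closed under pointwise products; 2. $\mathcal D$ is closed under composition (the product of power series) and contains $1$, and is thus a unital commutative ring; 3. $\mathcal D$ contains $\mathbb R[\partial_1,\dots,\partial_d]$ as a subring; 4. $\mathcal D\,\mathcal C\subseteq\mathcal C$, and $\mathcal C$ is a module over $\mathcal D$; real polynomials in the $\partial_j$ act as the usual differential operators, and for each $D=\sum_I c_I\partial_I\in\mathcal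 D$ there is a neighbourhood $U$ of $0$ such that $\widehat{Df}(\xi)=\sum_I c_I\,\widehat{\partial_If}(\xi)$ for all $f\in\mathcal C$ and $\xi\in U$, the sum over $I\in\mathbb N^d$ converging unconditionally; 5. the analytic Leibniz rule $D(fg)=\sum_{I,I'}\binom{I+I'}{I}c_{I+I'}(\partial_If)(\partial_{I'}g)$ holds pointwise near the origin in Fourier space, with the finitely many terms having the same $I+I'$ grouped together: for each $D=\sum_I c_I\partial_I\in\mathcal D$ there is a neighbourhood $U$ of $0$ such that for all $f,g\in\mathcal C$ and $\xi\in U$ $$\widehat{D(fg)}(\xi)=\sum_{J\in\mathbb N^d}\ \sum_{I+I'=J}\binom{I+I'}{I}\,c_{I+I'}\,\widehat{(\partial_If)(\partial_{I'}g)}(\xi),$$ the sum over $J$ converging unconditionally; 6. $\mathcal C\otimes_{\mathcal D}\mathcal C\cong\mathcal C$ by convolution: there is an isomorphism of $\mathcal D$-modules from $\mathcal C\otimes_{\mathcal D}\mathcal C$ onto $\mathcal C$ with $f\otimes g\mapsto f\star g$ (and these convolution integrals converge everywhere); 7. $\mathcal C$ is dense in $C^\infty(\mathbb R^d,\mathbb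 C)$ for the Fréchet topology, i.e. uniform convergence of all derivatives on compact sets. **Theorem.** Let $\mathcal C_0$ be the space of functions $f:\mathbb R^d\to\mathbb C$ for which there are $\epsilon,\delta,K>0$ such that $f$ extends analytically to $\mathbb R^d_\epsilon$ with $|f(x+\mathrm iy)|\le Ke^{-\delta\|x\|}$ there, and let $$\mathcal C=\{f\in C^\infty(\mathbb R^d,\mathbb C): \partial_If\in\mathcal C_0\text{ for all }I\in\mathbb N^d\}.$$ Let $\mathcal P_0$ be the space of functions $p:\mathbb R^d\to\mathbb C$ for which there is $\epsilon>0$ such that $p$ extends analytically to $\mathbb R^d_\epsilon$ and for every $\delta>0$ there is $C_\delta>0$ with $|p(x+\mathrm iy)|\le C_\delta e^{\delta\|x\|}$ there. A symbol $p\in\mathcal P_0$ defines the pseudo-differential operator $$f\mapsto\Big(x\mapsto(2\pi)^{-d}\int_{\mathbb R^d}p(\xi)\hat f(\xi)e^{\mathrm i\,\xi\cdot x}\,d\xi\Big),$$ i.e. multiplication by $p$ in Fourier space; its formal power series is $\sum_I(-\mathrm i)^{|I|}\frac{(\partial_Ip)(0)}{I!}\,\partial_I$. Let $\mathcal D_0\subseteq\mathbb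 C[\![\partial_1,\dots,\partial_d]\!]$ be the set of these power series, and let $$\mathcal D=\Big\{\sum_{k=1}^np_kq_k: n\in\mathbb N,\ p_k\in\mathcal D_0,\ q_k\in\mathbb R[\partial_1,\dots,\partial_d]\Big\}.$$ Then $(\mathcal C,\mathcal D)$, with the elements of $\mathcal D_0$ acting as the above pseudo-differential operators, is a convenient analytical setting. -/

import Mathlib

open MeasureTheory Topology
open scoped ContDiff TensorProduct

noncomputable section

namespace ConvAn

/-- Euclidean space `ℝ^d`. -/
abbrev E (d : ℕ) : Type := EuclideanSpace ℝ (Fin d)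

/-- Hermitian space `ℂ^d`. -/
abbrev EC (d : ℕ) : Type := EuclideanSpace ℂ (Fin d)

/-- The real part `x` of `z = x + iy`. -/
def rePart {d : ℕ} (z : EC d) : E d := WithLp.toLp 2 fun i => (z i).re

/-- The imaginary part `y` of `z = x + iy`. -/
def imPart {d : ℕ} (z : EC d) : E d := WithLp.toLp 2 fun i => (z i).im

/-- The inclusion `ℝ^d ⊆ ℂ^d`. -/
def toComplex {d : ℕ} (x : E d) : EC d := WithLp.toLp 2 fun i => (x i : ℂ)

/-- The open tube `{x + iy : ‖y‖ < ε}` around the real hyperplane. -/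
def tube (d : ℕ) (ε : ℝ) : Set (EC d) := {z | ‖imPart z‖ < ε}

/-- The partial derivative `∂_i f`. -/
def partialDeriv {d : ℕ} (i : Fin d) (f : E d → ℂ) : E d → ℂ :=
  fun x => fderiv ℝ f x (EuclideanSpace.single i 1)

/-- The multi-index derivative `∂_I f = ∂_1^{I_1} ⋯ ∂_d^{I_d} f`. -/
def multiDeriv {d : ℕ} (I : Fin d →₀ ℕ) (f : E d → ℂ) : E d → ℂ :=
  (List.finRange d).foldr (fun i g => (partialDeriv i)^[I i] g) f

/-- The multi-index binomial coefficient `∏ i, (J_i choose I_i)`. -/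
def multiChoose {d : ℕ} (J I : Fin d →₀ ℕ) : ℕ := ∏ i, (J i).choose (I i)

/-- The Fourier transform `ξ ↦ ∫ f(x) e^{-i⟨ξ, x⟩} dx`. -/
def fourierT {d : ℕ} (f : E d → ℂ) (ξ : E d) : ℂ :=
  ∫ x : E d, Complex.exp (-(Complex.I * (inner ℝ ξ x : ℝ))) * f x

/-- The pseudo-differential operator with symbol `p`, that is, multiplication by `p` in Fourier
space: `x ↦ (2π)^{-d} ∫ p(ξ) f̂(ξ) e^{i⟨ξ, x⟩} dξ`. -/
def pseudoDiff {d : ℕ} (p f : E d → ℂ) (x : E d) : ℂ :=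
  ((2 * Real.pi : ℝ) : ℂ)⁻¹ ^ d *
    ∫ ξ : E d, Complex.exp (Complex.I * (inner ℝ ξ x : ℝ)) * (p ξ * fourierT f ξ)

/-- The formal power series `∑ c_I ∂_I` of the pseudo-differential operator with symbol `p`.
As `∂_j` is multiplication by `i ξ_j` in Fourier space, the Taylor expansion
`p(ξ) = ∑ (∂_I p)(0) / I! · ξ^I` gives `c_I = (-i)^{|I|} (∂_I p)(0) / I!`. -/
def symbolSeries {d : ℕ} (p : E d → ℂ) : MvPowerSeries (Fin d) ℂ :=
  fun I => (-Complex.I) ^ I.degree * multiDeriv I p 0 / ((∏ i, (I i).factorial : ℕ) : ℂ)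

/-- A polynomial in `ℝ[∂_1, …, ∂_d]` as a formal power series in `ℂ⟦∂_1, …, ∂_d⟧`. -/
def polySeries {d : ℕ} (q : MvPolynomial (Fin d) ℝ) : MvPowerSeries (Fin d) ℂ :=
  ((MvPolynomial.map (algebraMap ℝ ℂ) q : MvPolynomial (Fin d) ℂ) : MvPowerSeries (Fin d) ℂ)

/-- The functions on `ℝ^d` that extend analytically to some tube, with exponential decay there. -/
def C0 (d : ℕ) : Set (E d → ℂ) :=
  {f | ∃ ε > 0, ∃ δ > 0, ∃ F : EC d → ℂ,
    AnalyticOnNhd ℂ F (tube d ε) ∧ (∀ x, F (toComplex x) = f x) ∧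
    ∃ K : ℝ, ∀ z ∈ tube d ε, ‖F z‖ ≤ K * Real.exp (-(δ * ‖rePart z‖))}

/-- The function space `𝒞`: smooth functions all of whose derivatives lie in `C0`. -/
def funcSpace (d : ℕ) : Set (E d → ℂ) :=
  {f | ContDiff ℝ ∞ f ∧ ∀ I : Fin d →₀ ℕ, multiDeriv I f ∈ C0 d}

/-- The symbols that extend analytically to some tube, with subexponential growth there. -/
def P0 (d : ℕ) : Set (E d → ℂ) :=
  {p | ∃ ε > 0, ∃ F : EC d → ℂ,
    AnalyticOnNhd ℂ F (tube d ε) ∧ (∀ x, F (toComplex x) = p x) ∧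
    ∀ δ > 0, ∃ K > 0, ∀ z ∈ tube d ε, ‖F z‖ ≤ K * Real.exp (δ * ‖rePart z‖)}

/-- The pseudo-differential operators with symbol in `P0`, as formal power series in the `∂_j`. -/
def D0 (d : ℕ) : Set (MvPowerSeries (Fin d) ℂ) := symbolSeries '' P0 d

/-- The operators `𝒟`: finite sums `∑ p_k q_k` with `p_k ∈ D0` and `q_k ∈ ℝ[∂_1, …, ∂_d]`. -/
def opRing (d : ℕ) : Set (MvPowerSeries (Fin d) ℂ) :=
  {P | ∃ (n : ℕ) (p : Fin n → MvPowerSeries (Fin d) ℂ) (q : Fin n → MvPolynomial (Fin d) ℝ),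
    (∀ k, p k ∈ D0 d) ∧ P = ∑ k, p k * polySeries (q k)}

/-- A convenient analytical setting on `ℝ^d`: a space of smooth functions, a ring of
(pseudo-)differential operators `∑ c_I ∂_I ∈ ℂ⟦∂_1, …, ∂_d⟧` and the action of the operators on the
functions. -/
structure ConvenientAnalyticalSetting (d : ℕ) where
  /-- The function space; a complex vector space closed under pointwise products. -/
  funcs : NonUnitalSubalgebra ℂ (E d → ℂ)
  /-- The functions are smooth. -/
  smooth : ∀ f ∈ funcs, ContDiff ℝ ∞ f
  /-- The functions are integrable, so that they have a Fourier transform. -/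
  integrable : ∀ f ∈ funcs, Integrable f
  /-- The operators; they contain `1` and are closed under composition, which is the product of
  formal power series. -/
  ops : Subring (MvPowerSeries (Fin d) ℂ)
  /-- All real polynomial differential operators are among the operators. -/
  poly_mem : ∀ q : MvPolynomial (Fin d) ℝ, polySeries q ∈ ops
  /-- The operators map functions of the space to such functions, and composites of operators act
  successively. -/
  [module : Module ops funcs]
  /-- The operators are complex linear. -/
  linear : ∀ (P : ops) (c : ℂ) (f : funcs), P • (c • f) = c • (P • f)
  /-- Real polynomial differential operators act in the usual way. -/
  poly_act : ∀ (q : MvPolynomial (Fin d) ℝ) (f : funcs) (x : E d),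
    (((⟨polySeries q, poly_mem q⟩ : ops) • f : funcs) : E d → ℂ) x =
      ∑ I ∈ q.support, ((MvPolynomial.coeff I q : ℝ) : ℂ) * multiDeriv I (f : E d → ℂ) x
  /-- The operator `P = ∑ c_I ∂_I` maps `f` to `∑ c_I ∂_I f`, in the sense of pointwise convergence
  on some neighbourhood of the origin in Fourier space. -/
  act_hasSum : ∀ P : ops, ∃ U ∈ 𝓝 (0 : E d), ∀ f : funcs, ∀ ξ ∈ U,
    HasSum
      (fun I : Fin d →₀ ℕ =>
        MvPowerSeries.coeff I (P : MvPowerSeries (Fin d) ℂ) *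
          fourierT (multiDeriv I (f : E d → ℂ)) ξ)
      (fourierT ((P • f : funcs) : E d → ℂ) ξ)
  /-- The analytic Leibniz rule, in the sense of pointwise convergence on some neighbourhood of the
  origin in Fourier space; for every multi-index `J`, the finitely many terms with `I + I' = J` are
  grouped together. -/
  leibniz : ∀ P : ops, ∃ U ∈ 𝓝 (0 : E d), ∀ f g : funcs, ∀ ξ ∈ U,
    HasSum
      (fun J : Fin d →₀ ℕ => ∑ I ∈ Finset.HasAntidiagonal.antidiagonal J,
        (multiChoose (I.1 + I.2) I.1 : ℂ) *
          MvPowerSeries.coeff (I.1 + I.2) (P : MvPowerSeries (Fin d) ℂ) *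
            fourierT (multiDeriv I.1 (f : E d → ℂ) * multiDeriv I.2 (g : E d → ℂ)) ξ)
      (fourierT ((P • (f * g) : funcs) : E d → ℂ) ξ)
  /-- Convolution induces an isomorphism of modules over the ring of operators, from the tensor
  square of the function space to the function space. -/
  tensor : ∃ e : (funcs ⊗[ops] funcs) ≃ₗ[ops] funcs, ∀ f g : funcs,
    ConvolutionExists (f : E d → ℂ) (g : E d → ℂ) (ContinuousLinearMap.mul ℂ ℂ) volume ∧
    ((e (f ⊗ₜ[ops] g) : funcs) : E d → ℂ) =
      convolution (f : E d → ℂ) (g : E d → ℂ) (ContinuousLinearMap.mul ℂ ℂ) volume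
  /-- The function space is dense in all smooth functions, in the Fréchet topology: uniform
  convergence of all derivatives on compact sets. -/
  dense : ∀ g : E d → ℂ, ContDiff ℝ ∞ g → ∀ K : Set (E d), IsCompact K → ∀ (N : ℕ), ∀ η > 0,
    ∃ f ∈ funcs, ∀ I : Fin d →₀ ℕ, I.degree ≤ N → ∀ x ∈ K,
      ‖multiDeriv I f x - multiDeriv I g x‖ < η

attribute [instance] ConvenientAnalyticalSetting.module

end ConvAn

end

/-! The Fourier transform turns every structure here into multiplication. By a Paley–Wiener argument
(`fourierT_mem_C0`) it maps `C0` into itself: exponential decay of f makes f̂ analytic in a tube,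
and analyticity of f in a tube makes f̂ decay exponentially, once the domain of integration is
shifted into the complex. Inversion makes it a bijection of `C0`. Moreover `C0` is an ideal of the
ring `P0`, since subexponential growth costs only part of an exponential decay. So symbols act on
`C0`; in particular ∂_j, which is multiplication by iξ_j, preserves `C0`, and `funcSpace` is just
`C0`.

Taking the formal Taylor series at 0, rescaled by -i, is a ring homomorphism on symbols, injective
by the identity theorem. Its image contains the polynomials, hence equals `opRing`, and each
operator has exactly one symbol. Near 0 a symbol is the unconditional sum of its multi-index Taylor
series; multiplication by f̂ gives the expansion of Pf, and the same expansion for fg, with ∂_J(fg)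
expanded, is the analytic Leibniz rule.

For the tensor square, s_a = ∏ 1/cosh(aξ_j) lies in `C0`, has no real zeros, and for small a divides
any given finite family in `C0` with quotients in `C0` ⊆ `P0`. So every tensor has the form u ⊗ g
with û = s_a; its convolution has transform s_a ĝ, which vanishes only for g = 0. Surjectivity is
the factorisation m̂ = s_a · (m̂ / s_a).

For density, cut a smooth function off to a compactly supported φ and multiply φ̂ by s_a; as a → 0
every derivative converges uniformly. -/

noncomputable section

namespace ConvAn

variable {d : ℕ}

/-! ### Real and imaginary parts, and tubes -/

section Geometry

@[simp] lemma rePart_apply (z : EC d) (i : Fin d) : rePart z i = (z i).re := rfl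

@[simp] lemma imPart_apply (z : EC d) (i : Fin d) : imPart z i = (z i).im := rfl

@[simp] lemma toComplex_apply (x : E d) (i : Fin d) : toComplex x i = (x i : ℂ) := rfl

/-- The inclusion `ℝ^d ⊆ ℂ^d` as a continuous real linear map. -/
def toComplexL (d : ℕ) : E d →L[ℝ] EC d :=
  LinearMap.toContinuousLinearMap
    { toFun := toComplex
      map_add' := fun x y => by ext i; simp
      map_smul' := fun c x => by ext i; simp }

/-- The real part as a continuous real linear map. -/
def rePartL (d : ℕ) : EC d →L[ℝ] E d :=
  LinearMap.toContinuousLinearMap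
    { toFun := rePart
      map_add' := fun x y => by ext i; simp
      map_smul' := fun c x => by ext i; simp }

/-- The imaginary part as a continuous real linear map. -/
def imPartL (d : ℕ) : EC d →L[ℝ] E d :=
  LinearMap.toContinuousLinearMap
    { toFun := imPart
      map_add' := fun x y => by ext i; simp
      map_smul' := fun c x => by ext i; simp }

lemma continuous_toComplex : Continuous (toComplex : E d → EC d) := (toComplexL d).continuous

lemma toComplex_add (x y : E d) : toComplex (x + y) = toComplex x + toComplex y :=
  (toComplexL d).map_add x y

lemma rePart_add (z w : EC d) : rePart (z + w) = rePart z + rePart w := (rePartL d).map_add z w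

lemma imPart_add (z w : EC d) : imPart (z + w) = imPart z + imPart w := (imPartL d).map_add z w

lemma rePart_neg (z : EC d) : rePart (-z) = -rePart z := (rePartL d).map_neg z

lemma imPart_neg (z : EC d) : imPart (-z) = -imPart z := (imPartL d).map_neg z

@[simp] lemma toComplex_neg (x : E d) : toComplex (-x) = -toComplex x := (toComplexL d).map_neg x

@[simp] lemma rePart_toComplex (x : E d) : rePart (toComplex x) = x := by ext i; simp

@[simp] lemma imPart_toComplex (x : E d) : imPart (toComplex x) = 0 := by ext i; simp

@[simp] lemma rePart_smul_toComplex (s : ℂ) (v : E d) : rePart (s • toComplex v) = s.re • v := by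
  ext i; simp

@[simp] lemma imPart_smul_toComplex (s : ℂ) (v : E d) : imPart (s • toComplex v) = s.im • v := by
  ext i; simp

lemma toComplex_smul (r : ℝ) (x : E d) : toComplex (r • x) = (r : ℂ) • toComplex x := by
  ext i; simp

@[simp] lemma norm_toComplex (x : E d) : ‖toComplex x‖ = ‖x‖ := by
  simp [EuclideanSpace.norm_eq]

lemma norm_apply_le_rePart_add_imPart (z : EC d) (i : Fin d) : ‖z i‖ ≤ ‖rePart z‖ + ‖imPart z‖ := by
  refine (Complex.norm_le_abs_re_add_abs_im (z i)).trans (add_le_add ?_ ?_)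
  · simpa using PiLp.norm_apply_le (rePart z) i
  · simpa using PiLp.norm_apply_le (imPart z) i

lemma tube_mono {ε ε' : ℝ} (h : ε ≤ ε') : tube d ε ⊆ tube d ε' :=
  fun _ hz => lt_of_lt_of_le hz h

lemma toComplex_mem_tube {ε : ℝ} (hε : 0 < ε) (x : E d) : toComplex x ∈ tube d ε := by
  simpa [tube] using hε

lemma analyticAt_apply (i : Fin d) (z : EC d) : AnalyticAt ℂ (fun w : EC d => w i) z :=
  (EuclideanSpace.proj (𝕜 := ℂ) i).analyticAt z

end Geometry

/-! ### Integrability of exponential decay -/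

section ExpDecay

/-- A single term of the series of exp(δ(1 + t)) bounds it from below; this trades exponential for
polynomial decay, whose integrability is known. -/
lemma exp_neg_mul_norm_le (n : ℕ) {δ : ℝ} (hδ : 0 < δ) (t : ℝ) (ht : 0 ≤ t) :
    Real.exp (-(δ * t)) ≤ (Real.exp δ * n.factorial / δ ^ n) * (1 + t) ^ (-(n : ℝ)) := by
  have h := Real.pow_div_factorial_le_exp (δ * (1 + t)) (by positivity) n
  have h1 : Real.exp (δ * (1 + t)) = Real.exp δ * Real.exp (δ * t) := by
    rw [← Real.exp_add]; ring_nf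
  rw [Real.rpow_neg (by positivity), Real.rpow_natCast, Real.exp_neg, ← one_div, div_le_iff₀
    (Real.exp_pos _)]
  rw [h1, mul_pow, div_le_iff₀ (by positivity)] at h
  have : Real.exp δ * n.factorial / δ ^ n * ((1 + t) ^ n)⁻¹ * Real.exp (δ * t)
      = (Real.exp δ * Real.exp (δ * t) * n.factorial) / (δ ^ n * (1 + t) ^ n) := by
    field_simp
  rw [this, le_div_iff₀ (by positivity)]
  linarith

lemma integrable_exp_neg_norm {δ : ℝ} (hδ : 0 < δ) :
    Integrable (fun x : E d => Real.exp (-(δ * ‖x‖))) := by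
  have h := (integrable_one_add_norm (E := E d) (μ := volume) (r := ((d + 1 : ℕ) : ℝ))
    (by simp)).const_mul (Real.exp δ * (d + 1).factorial / δ ^ (d + 1))
  refine h.mono' (by fun_prop) (Filter.Eventually.of_forall fun x => ?_)
  rw [Real.norm_of_nonneg (Real.exp_pos _).le]
  exact exp_neg_mul_norm_le _ hδ _ (norm_nonneg x)

end ExpDecay

/-! ### Algebra of the classes `C0` and `P0` -/

section Classes

variable {f g : E d → ℂ} {c : ℂ}

lemma C0_subset_P0 : C0 d ⊆ P0 d := by
  rintro f ⟨ε, hε, δ, hδ, F, hF, hFf, K, hK⟩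
  refine ⟨ε, hε, F, hF, hFf, fun δ' hδ' => ⟨|K| + 1, by positivity, fun z hz => ?_⟩⟩
  refine (hK z hz).trans ?_
  have h1 : Real.exp (-(δ * ‖rePart z‖)) ≤ 1 := Real.exp_le_one_iff.2 (by
    have := norm_nonneg (rePart z); nlinarith)
  have h2 : 1 ≤ Real.exp (δ' * ‖rePart z‖) := Real.one_le_exp (by positivity)
  calc K * Real.exp (-(δ * ‖rePart z‖)) ≤ (|K| + 1) * Real.exp (-(δ * ‖rePart z‖)) := by
        gcongr; linarith [le_abs_self K]
    _ ≤ (|K| + 1) * Real.exp (δ' * ‖rePart z‖) :=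
        mul_le_mul_of_nonneg_left (h1.trans h2) (by positivity)

lemma analyticOnNhd_of_mem_P0 (hf : f ∈ P0 d) : AnalyticOnNhd ℝ f Set.univ := by
  obtain ⟨ε, hε, F, hF, hFf, -⟩ := hf
  intro x _
  have h1 : AnalyticAt ℝ F (toComplexL d x) :=
    (hF _ (toComplex_mem_tube hε x)).restrictScalars
  have h2 := h1.comp ((toComplexL d).analyticAt x)
  have : F ∘ (toComplexL d) = f := funext hFf
  rwa [this] at h2

lemma contDiff_of_mem_P0 (hf : f ∈ P0 d) : ContDiff ℝ ∞ f :=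
  (analyticOnNhd_of_mem_P0 hf).contDiff

lemma bound_of_mem_C0 (hf : f ∈ C0 d) :
    ∃ δ > 0, ∃ K : ℝ, ∀ x, ‖f x‖ ≤ K * Real.exp (-(δ * ‖x‖)) := by
  obtain ⟨ε, hε, δ, hδ, F, hF, hFf, K, hK⟩ := hf
  exact ⟨δ, hδ, K, fun x => by simpa [hFf] using hK _ (toComplex_mem_tube hε x)⟩

lemma contDiff_of_mem_C0 (hf : f ∈ C0 d) : ContDiff ℝ ∞ f := contDiff_of_mem_P0 (C0_subset_P0 hf)

lemma continuous_of_mem_C0 (hf : f ∈ C0 d) : Continuous f := (contDiff_of_mem_C0 hf).continuous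

lemma integrable_of_mem_C0 (hf : f ∈ C0 d) : Integrable f := by
  obtain ⟨δ, hδ, K, hK⟩ := bound_of_mem_C0 hf
  exact ((integrable_exp_neg_norm hδ).const_mul K).mono'
    (continuous_of_mem_C0 hf).aestronglyMeasurable (Filter.Eventually.of_forall hK)

lemma add_mem_P0 (hf : f ∈ P0 d) (hg : g ∈ P0 d) : f + g ∈ P0 d := by
  obtain ⟨ε, hε, F, hF, hFf, hF'⟩ := hf
  obtain ⟨η, hη, G, hG, hGg, hG'⟩ := hg
  refine ⟨min ε η, lt_min hε hη, F + G,
    (hF.mono (tube_mono (min_le_left _ _))).add (hG.mono (tube_mono (min_le_right _ _))),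
    fun x => by simp [hFf, hGg], fun δ hδ => ?_⟩
  obtain ⟨K, hK, hFK⟩ := hF' δ hδ
  obtain ⟨L, hL, hGL⟩ := hG' δ hδ
  refine ⟨K + L, by positivity, fun z hz => (norm_add_le _ _).trans ?_⟩
  rw [add_mul]
  exact add_le_add (hFK z (tube_mono (min_le_left _ _) hz)) (hGL z (tube_mono (min_le_right _ _) hz))

lemma mul_mem_P0 (hf : f ∈ P0 d) (hg : g ∈ P0 d) : f * g ∈ P0 d := by
  obtain ⟨ε, hε, F, hF, hFf, hF'⟩ := hf
  obtain ⟨η, hη, G, hG, hGg, hG'⟩ := hg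
  refine ⟨min ε η, lt_min hε hη, F * G,
    (hF.mono (tube_mono (min_le_left _ _))).mul (hG.mono (tube_mono (min_le_right _ _))),
    fun x => by simp [hFf, hGg], fun δ hδ => ?_⟩
  obtain ⟨K, hK, hFK⟩ := hF' (δ / 2) (by positivity)
  obtain ⟨L, hL, hGL⟩ := hG' (δ / 2) (by positivity)
  refine ⟨K * L, by positivity, fun z hz => ?_⟩
  have h1 := hFK z (tube_mono (min_le_left _ _) hz)
  have h2 := hGL z (tube_mono (min_le_right _ _) hz)
  calc ‖(F * G) z‖ = ‖F z‖ * ‖G z‖ := norm_mul _ _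
    _ ≤ (K * Real.exp (δ / 2 * ‖rePart z‖)) * (L * Real.exp (δ / 2 * ‖rePart z‖)) := by gcongr
    _ = K * L * (Real.exp (δ / 2 * ‖rePart z‖) * Real.exp (δ / 2 * ‖rePart z‖)) := by ring
    _ = K * L * Real.exp (δ * ‖rePart z‖) := by rw [← Real.exp_add]; ring_nf

lemma const_mem_P0 (c : ℂ) : (fun _ : E d => c) ∈ P0 d := by
  refine ⟨1, one_pos, fun _ => c, analyticOnNhd_const, fun _ => rfl, fun δ hδ =>
    ⟨‖c‖ + 1, by positivity, fun z _ => ?_⟩⟩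
  have h2 : 1 ≤ Real.exp (δ * ‖rePart z‖) := Real.one_le_exp (by positivity)
  nlinarith [norm_nonneg c]

lemma coord_mem_P0 (i : Fin d) : (fun x : E d => (x i : ℂ)) ∈ P0 d := by
  refine ⟨1, one_pos, fun z => z i, fun z _ => analyticAt_apply i z, fun x => rfl, fun δ hδ =>
    ⟨1 / δ + 1, by positivity, fun z hz => ?_⟩⟩
  have h1 := norm_apply_le_rePart_add_imPart z i
  have h2 : ‖imPart z‖ < 1 := hz
  have h3 := Real.add_one_le_exp (δ * ‖rePart z‖)
  have h4 : 1 ≤ Real.exp (δ * ‖rePart z‖) := Real.one_le_exp (by positivity)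
  have h5 : ‖rePart z‖ ≤ 1 / δ * Real.exp (δ * ‖rePart z‖) := by
    rw [div_mul_eq_mul_div, le_div_iff₀ hδ]; linarith
  linarith

/-- Half of the decay rate of g pays for the growth of f. This ideal property gives both the action
of the symbols and the closure of `C0` under products. -/
lemma mul_mem_C0 (hf : f ∈ P0 d) (hg : g ∈ C0 d) : f * g ∈ C0 d := by
  obtain ⟨ε, hε, F, hF, hFf, hF'⟩ := hf
  obtain ⟨η, hη, δ, hδ, G, hG, hGg, L, hGL⟩ := hg
  obtain ⟨K, hK, hFK⟩ := hF' (δ / 2) (by positivity)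
  refine ⟨min ε η, lt_min hε hη, δ / 2, by positivity, F * G,
    (hF.mono (tube_mono (min_le_left _ _))).mul (hG.mono (tube_mono (min_le_right _ _))),
    fun x => by simp [hFf, hGg], K * L, fun z hz => ?_⟩
  have h1 := hFK z (tube_mono (min_le_left _ _) hz)
  have h2 := hGL z (tube_mono (min_le_right _ _) hz)
  calc ‖(F * G) z‖ = ‖F z‖ * ‖G z‖ := norm_mul _ _
    _ ≤ (K * Real.exp (δ / 2 * ‖rePart z‖)) * (L * Real.exp (-(δ * ‖rePart z‖))) := by gcongr
    _ = K * L * (Real.exp (δ / 2 * ‖rePart z‖) * Real.exp (-(δ * ‖rePart z‖))) := by ring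
    _ = K * L * Real.exp (-(δ / 2 * ‖rePart z‖)) := by rw [← Real.exp_add]; ring_nf

lemma smul_mem_C0 (c : ℂ) (hf : f ∈ C0 d) : c • f ∈ C0 d :=
  mul_mem_C0 (const_mem_P0 c) hf

lemma zero_mem_C0 : (0 : E d → ℂ) ∈ C0 d :=
  ⟨1, one_pos, 1, one_pos, 0, analyticOnNhd_const, fun _ => rfl, 0, fun z _ => by simp⟩

lemma add_mem_C0 (hf : f ∈ C0 d) (hg : g ∈ C0 d) : f + g ∈ C0 d := by
  obtain ⟨ε, hε, δ, hδ, F, hF, hFf, K, hFK⟩ := hf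
  obtain ⟨η, hη, δ', hδ', G, hG, hGg, L, hGL⟩ := hg
  refine ⟨min ε η, lt_min hε hη, min δ δ', lt_min hδ hδ', F + G,
    (hF.mono (tube_mono (min_le_left _ _))).add (hG.mono (tube_mono (min_le_right _ _))),
    fun x => by simp [hFf, hGg], |K| + |L|, fun z hz => (norm_add_le _ _).trans ?_⟩
  have h1 := hFK z (tube_mono (min_le_left _ _) hz)
  have h2 := hGL z (tube_mono (min_le_right _ _) hz)
  rw [add_mul]
  refine add_le_add (h1.trans ?_) (h2.trans ?_)
  · gcongr
    exacts [le_abs_self K, min_le_left _ _]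
  · gcongr
    exacts [le_abs_self L, min_le_right _ _]

lemma comp_neg_mem_C0 (hf : f ∈ C0 d) : (fun x => f (-x)) ∈ C0 d := by
  obtain ⟨ε, hε, δ, hδ, F, hF, hFf, K, hFK⟩ := hf
  refine ⟨ε, hε, δ, hδ, fun z => F (-z), ?_, fun x => by simp [← hFf], K, fun z hz => ?_⟩
  · intro z hz
    have h : AnalyticAt ℂ F (-z) := hF _ (by simpa [tube, imPart_neg] using hz)
    exact h.comp_of_eq analyticAt_id.neg rfl
  · simpa [rePart_neg] using hFK (-z) (by simpa [tube, imPart_neg] using hz)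

end Classes

/-! ### The bilinear pairing on ℂ^d -/

section Pairing

/-- The complex bilinear pairing `∑ ζ_i z_i` on `ℂ^d`. -/
def cpair (d : ℕ) : EC d →L[ℂ] EC d →L[ℂ] ℂ :=
  ∑ i, (EuclideanSpace.proj (𝕜 := ℂ) i : EC d →L[ℂ] ℂ).smulRight
    (EuclideanSpace.proj (𝕜 := ℂ) i : EC d →L[ℂ] ℂ)

lemma cpair_apply (ζ z : EC d) : cpair d ζ z = ∑ i, ζ i * z i := by
  simp [cpair]

lemma cpair_toComplex (ξ x : E d) : cpair d (toComplex ξ) (toComplex x) = (inner ℝ ξ x : ℝ) := by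
  simp [cpair_apply, PiLp.inner_apply, mul_comm]

lemma im_cpair (ζ z : EC d) :
    (cpair d ζ z).im = inner ℝ (rePart ζ) (imPart z) + inner ℝ (imPart ζ) (rePart z) := by
  simp only [cpair_apply, Complex.im_sum, Complex.mul_im, PiLp.inner_apply, rePart_apply,
    imPart_apply, RCLike.inner_apply, conj_trivial, ← Finset.sum_add_distrib]
  exact Finset.sum_congr rfl fun i _ => by ring

lemma norm_exp_neg_I_mul_cpair (ζ z : EC d) :
    ‖Complex.exp (-(Complex.I * cpair d ζ z))‖
      = Real.exp (inner ℝ (rePart ζ) (imPart z) + inner ℝ (imPart ζ) (rePart z)) := by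
  rw [Complex.norm_exp, ← im_cpair]
  simp

lemma norm_cpair_toComplex_le (ζ : EC d) (x : E d) : ‖cpair d ζ (toComplex x)‖ ≤ ‖ζ‖ * ‖x‖ := by
  have : cpair d ζ (toComplex x) = inner ℂ (toComplex x) ζ := by
    simp [cpair_apply, PiLp.inner_apply]
  rw [this, mul_comm, ← norm_toComplex x]
  exact norm_inner_le_norm _ _

end Pairing

/-! ### Power series of integrals of exponentials -/

section ExponentialIntegrals

/-- The `n`-th power of a linear form as a continuous multilinear map. -/
def linearPow (n : ℕ) (l : EC d →L[ℂ] ℂ) : ContinuousMultilinearMap ℂ (fun _ : Fin n => EC d) ℂ :=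
  (ContinuousMultilinearMap.mkPiAlgebra ℂ (Fin n) ℂ).compContinuousLinearMap fun _ => l

lemma linearPow_apply (n : ℕ) (l : EC d →L[ℂ] ℂ) (ζ : EC d) :
    linearPow n l (fun _ => ζ) = l ζ ^ n := by
  simp [linearPow]

lemma norm_linearPow_le (n : ℕ) (l : EC d →L[ℂ] ℂ) : ‖linearPow n l‖ ≤ ‖l‖ ^ n := by
  refine (ContinuousMultilinearMap.norm_compContinuousLinearMap_le _ _).trans ?_
  simp

lemma continuous_linearPow (n : ℕ) : Continuous (linearPow n : (EC d →L[ℂ] ℂ) → _) :=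
  ((ContinuousMultilinearMap.compContinuousLinearMapContinuousMultilinear ℂ
    (fun _ : Fin n => EC d) (fun _ => ℂ) ℂ).cont.comp
      (continuous_pi fun _ => continuous_id)).clm_apply continuous_const

variable {c : E d → ℂ} {r : NNReal}

lemma integrable_mul_pow_div_factorial (hc : AEStronglyMeasurable c)
    (hint : Integrable fun x => Real.exp (r * ‖x‖) * ‖c x‖) (n : ℕ) :
    Integrable (fun x => ‖c x‖ * ((r * ‖x‖) ^ n / n.factorial)) := by
  refine hint.mono' (hc.norm.mul (by fun_prop)) (Filter.Eventually.of_forall fun x => ?_)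
  rw [Real.norm_of_nonneg (by positivity), mul_comm]
  gcongr
  exact Real.pow_div_factorial_le_exp _ (by positivity) n

/-- An integral of exponentials of linear forms is given by a power series. -/
lemma hasFPowerSeriesOnBall_integral_exp (hc : AEStronglyMeasurable c) (hr : 0 < r)
    (hint : Integrable fun x => Real.exp (r * ‖x‖) * ‖c x‖)
    (L : E d → (EC d →L[ℂ] ℂ)) (hL : Continuous L) (hLx : ∀ x, ‖L x‖ ≤ ‖x‖) :
    HasFPowerSeriesOnBall (fun ζ => ∫ x, c x * Complex.exp (L x ζ))
      (fun n => ∫ x, (c x / n.factorial) • linearPow n (L x)) 0 r := by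
  have hcn : ∀ n : ℕ, AEStronglyMeasurable (fun x => c x / n.factorial) := fun n => by
    simp only [div_eq_mul_inv]
    exact hc.mul aestronglyMeasurable_const
  have hmeas : ∀ n : ℕ, AEStronglyMeasurable
      (fun x => (c x / n.factorial) • linearPow n (L x)) := fun n =>
    (hcn n).smul ((continuous_linearPow n).comp hL).aestronglyMeasurable
  -- The n-th term is at most ‖c x‖ times the n-th term of the series of exp(r‖x‖), so `hint`
  -- controls the radius of convergence as well as the interchange of sum and integral.
  have hbd : ∀ (n : ℕ) (x : E d), ‖(c x / n.factorial) • linearPow n (L x)‖ * (r : ℝ) ^ n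
      ≤ ‖c x‖ * ((r * ‖x‖) ^ n / n.factorial) := fun n x => by
    rw [norm_smul, norm_div, Complex.norm_natCast, mul_pow]
    have h1 : ‖linearPow n (L x)‖ ≤ ‖x‖ ^ n :=
      (norm_linearPow_le n _).trans (pow_le_pow_left₀ (norm_nonneg _) (hLx x) n)
    calc ‖c x‖ / n.factorial * ‖linearPow n (L x)‖ * (r : ℝ) ^ n
        ≤ ‖c x‖ / n.factorial * ‖x‖ ^ n * (r : ℝ) ^ n := by gcongr
      _ = _ := by ring
  have hrn : ∀ n : ℕ, (0 : ℝ) < (r : ℝ) ^ n := fun n => pow_pos hr n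
  have hInt : ∀ n : ℕ, Integrable (fun x => (c x / n.factorial) • linearPow n (L x)) := fun n => by
    refine ((integrable_mul_pow_div_factorial hc hint n).const_mul ((r : ℝ) ^ n)⁻¹).mono' (hmeas n)
      (Filter.Eventually.of_forall fun x => ?_)
    rw [← div_eq_inv_mul, le_div_iff₀ (hrn n)]
    exact hbd n x
  refine ⟨?_, by simpa using hr, fun {y} hy => ?_⟩
  · refine FormalMultilinearSeries.le_radius_of_bound _
      (∫ x, Real.exp (r * ‖x‖) * ‖c x‖) fun n => ?_
    calc ‖∫ x, (c x / n.factorial) • linearPow n (L x)‖ * (r : ℝ) ^ n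
        ≤ (∫ x, ‖(c x / n.factorial) • linearPow n (L x)‖) * (r : ℝ) ^ n := by
          gcongr; exact norm_integral_le_integral_norm _
      _ = ∫ x, ‖(c x / n.factorial) • linearPow n (L x)‖ * (r : ℝ) ^ n :=
          (integral_mul_const _ _).symm
      _ ≤ _ := by
          refine integral_mono ((hInt n).norm.mul_const _) hint fun x => (hbd n x).trans ?_
          rw [mul_comm]
          gcongr
          exact Real.pow_div_factorial_le_exp _ (by positivity) n
  · have hy' : ‖y‖ < r := by simpa [← ofReal_norm, ENNReal.ofReal_lt_coe_iff] using hy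
    rw [zero_add]
    have happ : ∀ n : ℕ, (∫ x, (c x / n.factorial) • linearPow n (L x)) (fun _ => y)
        = ∫ x, c x / n.factorial * (L x y) ^ n := fun n => by
      rw [ContinuousMultilinearMap.integral_apply (hInt n)]
      simp [linearPow_apply]
    simp_rw [happ]
    have hexp : ∀ x : E d, HasSum (fun n : ℕ => ‖c x‖ * ((r * ‖x‖) ^ n / n.factorial))
        (‖c x‖ * Real.exp (r * ‖x‖)) := fun x => by
      rw [Real.exp_eq_exp_ℝ]
      exact (NormedSpace.expSeries_div_hasSum_exp (r * ‖x‖)).mul_left _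
    refine hasSum_integral_of_dominated_convergence
      (fun n x => ‖c x‖ * ((r * ‖x‖) ^ n / n.factorial)) (fun n => ?_) (fun n => ?_) ?_ ?_ ?_
    · exact (hcn n).mul (((hL.clm_apply continuous_const).pow n).aestronglyMeasurable)
    · refine Filter.Eventually.of_forall fun x => ?_
      rw [norm_mul, norm_div, Complex.norm_natCast, norm_pow, div_mul_eq_mul_div, mul_div_assoc]
      gcongr
      calc ‖L x y‖ ≤ ‖L x‖ * ‖y‖ := (L x).le_opNorm y
        _ ≤ ‖x‖ * r := by gcongr; exact hLx x
        _ = r * ‖x‖ := mul_comm _ _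
    · exact Filter.Eventually.of_forall fun x => (hexp x).summable
    · refine hint.congr (Filter.Eventually.of_forall fun x => ?_)
      simp only [(hexp x).tsum_eq, mul_comm]
    · refine Filter.Eventually.of_forall fun x => ?_
      rw [Complex.exp_eq_exp_ℂ]
      have := (NormedSpace.expSeries_div_hasSum_exp (L x y)).mul_left (c x)
      refine this.congr_fun fun n => ?_
      ring

end ExponentialIntegrals

/-! ### Analyticity of the Fourier transform -/

section FourierExtension

variable {f : E d → ℂ} {δ : ℝ}

/-- The Fourier integral at a complex frequency. -/
def fourierExt (f : E d → ℂ) (ζ : EC d) : ℂ :=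
  ∫ x : E d, Complex.exp (-(Complex.I * cpair d ζ (toComplex x))) * f x

lemma fourierExt_toComplex (f : E d → ℂ) (ξ : E d) :
    fourierExt f (toComplex ξ) = fourierT f ξ := by
  simp [fourierExt, fourierT, cpair_toComplex]

/-- The linear form `ζ ↦ -i ∑ ζ_j x_j`. -/
def phase (x : E d) : EC d →L[ℂ] ℂ := (-Complex.I) • (cpair d).flip (toComplex x)

lemma phase_apply (x : E d) (ζ : EC d) : phase x ζ = -(Complex.I * cpair d ζ (toComplex x)) := by
  simp [phase]

lemma continuous_phase : Continuous (phase : E d → EC d →L[ℂ] ℂ) :=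
  ((cpair d).flip.continuous.comp continuous_toComplex).const_smul (-Complex.I)

lemma norm_phase_le (x : E d) : ‖phase x‖ ≤ ‖x‖ :=
  ContinuousLinearMap.opNorm_le_bound _ (norm_nonneg _) fun ζ => by
    simpa [phase_apply, mul_comm] using norm_cpair_toComplex_le ζ x

lemma norm_exp_phase_le (x : E d) (ζ : EC d) :
    ‖Complex.exp (phase x ζ)‖ ≤ Real.exp (‖imPart ζ‖ * ‖x‖) := by
  rw [phase_apply, norm_exp_neg_I_mul_cpair]
  simpa using real_inner_le_norm (imPart ζ) x

/-- Expand about ζ₀ by absorbing the exponential at ζ₀ into the weight. This uses up ‖Im ζ₀‖ of the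
exponential moment δ and leaves a ball of radius δ - ‖Im ζ₀‖. -/
lemma analyticOnNhd_fourierExt (hf : AEStronglyMeasurable f)
    (hint : Integrable fun x => Real.exp (δ * ‖x‖) * ‖f x‖) :
    AnalyticOnNhd ℂ (fourierExt f) (tube d δ) := by
  intro ζ₀ hζ₀
  have hr : 0 < δ - ‖imPart ζ₀‖ := sub_pos.2 hζ₀
  have hmeas : AEStronglyMeasurable (fun x => Complex.exp (phase x ζ₀) * f x) :=
    (Complex.continuous_exp.comp
      (continuous_phase.clm_apply continuous_const)).aestronglyMeasurable.mul hf
  have key := hasFPowerSeriesOnBall_integral_exp (c := fun x => Complex.exp (phase x ζ₀) * f x)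
    (r := (δ - ‖imPart ζ₀‖).toNNReal) hmeas (by simpa using hr)
    (by
      refine hint.mono' (AEStronglyMeasurable.mul (by fun_prop) hmeas.norm)
        (Filter.Eventually.of_forall fun x => ?_)
      rw [Real.norm_of_nonneg (by positivity), Real.coe_toNNReal _ hr.le, norm_mul]
      calc Real.exp ((δ - ‖imPart ζ₀‖) * ‖x‖) * (‖Complex.exp (phase x ζ₀)‖ * ‖f x‖)
          ≤ Real.exp ((δ - ‖imPart ζ₀‖) * ‖x‖) * (Real.exp (‖imPart ζ₀‖ * ‖x‖) * ‖f x‖) := by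
            gcongr; exact norm_exp_phase_le x ζ₀
        _ = Real.exp (δ * ‖x‖) * ‖f x‖ := by
            rw [← mul_assoc, ← Real.exp_add]; ring_nf)
    phase continuous_phase norm_phase_le
  have h2 := (key.comp_sub ζ₀).analyticAt
  rw [zero_add] at h2
  refine h2.congr (Filter.Eventually.of_forall fun ζ => ?_)
  refine integral_congr_ae (Filter.Eventually.of_forall fun x => ?_)
  simp only [← phase_apply, map_sub, Complex.exp_sub]
  field_simp

lemma norm_fourierExt_le {ζ : EC d} (hζ : ζ ∈ tube d δ)
    (hint : Integrable fun x => Real.exp (δ * ‖x‖) * ‖f x‖) :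
    ‖fourierExt f ζ‖ ≤ ∫ x, Real.exp (δ * ‖x‖) * ‖f x‖ := by
  refine norm_integral_le_of_norm_le hint (Filter.Eventually.of_forall fun x => ?_)
  rw [norm_mul, ← phase_apply]
  gcongr
  refine (norm_exp_phase_le x ζ).trans ?_
  gcongr
  exact le_of_lt hζ

end FourierExtension

/-! ### Shifting the domain of integration -/

section ContourShift

variable {ε A b : ℝ} {Φ : EC d → ℂ} {v : E d}

/-- The strip |Im s| < 2 contains both s = 0 and s = i in its interior, so the integral can be
studied as a holomorphic function on an open set joining the two. -/
lemma line_mem_tube (hv : 2 * ‖v‖ ≤ ε) (hε : 0 < ε) {s : ℂ} (hs : |s.im| < 2) (x : E d) :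
    toComplex x + s • toComplex v ∈ tube d ε := by
  change ‖imPart _‖ < ε
  rw [imPart_add, imPart_toComplex, imPart_smul_toComplex, zero_add, norm_smul, Real.norm_eq_abs]
  rcases (norm_nonneg v).eq_or_lt with h | h
  · rw [← h]; simpa using hε
  · nlinarith

lemma norm_line_le (hΦb : ∀ z ∈ tube d ε, ‖Φ z‖ ≤ A * Real.exp (-(b * ‖rePart z‖)))
    (hA : 0 ≤ A) (hb : 0 ≤ b) (hv : 2 * ‖v‖ ≤ ε) (hε : 0 < ε) {s : ℂ} (hs : |s.im| < 2) {R : ℝ}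
    (hR : ‖s‖ ≤ R) (x : E d) :
    ‖Φ (toComplex x + s • toComplex v)‖ ≤
      A * Real.exp (b * (R * ‖v‖)) * Real.exp (-(b * ‖x‖)) := by
  refine (hΦb _ (line_mem_tube hv hε hs x)).trans ?_
  rw [mul_assoc, ← Real.exp_add, rePart_add, rePart_toComplex, rePart_smul_toComplex]
  gcongr
  have h1 : ‖x‖ ≤ ‖x + s.re • v‖ + ‖s.re • v‖ := by
    simpa using norm_sub_le (x + s.re • v) (s.re • v)
  have h2 : ‖s.re • v‖ ≤ R * ‖v‖ := by
    rw [norm_smul]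
    gcongr
    exact (Complex.abs_re_le_norm s).trans hR
  nlinarith

lemma hasDerivAt_line (hΦ : AnalyticOnNhd ℂ Φ (tube d ε)) (hv : 2 * ‖v‖ ≤ ε) (hε : 0 < ε) {s : ℂ}
    (hs : |s.im| < 2) (x : E d) :
    HasDerivAt (fun s : ℂ => Φ (toComplex x + s • toComplex v))
      (fderiv ℂ Φ (toComplex x + s • toComplex v) (toComplex v)) s := by
  have h1 := (hΦ _ (line_mem_tube hv hε hs x)).differentiableAt.hasFDerivAt
  have h2 : HasDerivAt (fun s : ℂ => toComplex x + s • toComplex v) (toComplex v) s := by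
    simpa using ((hasDerivAt_id s).smul_const (toComplex v)).const_add (toComplex x)
  exact h1.comp_hasDerivAt s h2

lemma continuous_comp_line {X : Type*} [TopologicalSpace X] {Ψ : EC d → X}
    (hΨ : ContinuousOn Ψ (tube d ε)) (hv : 2 * ‖v‖ ≤ ε) (hε : 0 < ε) {s : ℂ} (hs : |s.im| < 2) :
    Continuous fun x : E d => Ψ (toComplex x + s • toComplex v) :=
  hΨ.comp_continuous (continuous_toComplex.add continuous_const) (line_mem_tube hv hε hs)

lemma isOpen_strip : IsOpen {s : ℂ | |s.im| < 2} :=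
  isOpen_lt Complex.continuous_im.abs continuous_const

lemma integrable_line (hΦ : AnalyticOnNhd ℂ Φ (tube d ε))
    (hΦb : ∀ z ∈ tube d ε, ‖Φ z‖ ≤ A * Real.exp (-(b * ‖rePart z‖)))
    (hA : 0 ≤ A) (hb : 0 < b) (hv : 2 * ‖v‖ ≤ ε) (hε : 0 < ε) {s : ℂ} (hs : |s.im| < 2) :
    Integrable fun x : E d => Φ (toComplex x + s • toComplex v) :=
  ((integrable_exp_neg_norm hb).const_mul _).mono'
    (continuous_comp_line hΦ.continuousOn hv hε hs).aestronglyMeasurable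
    (Filter.Eventually.of_forall fun x => norm_line_le hΦb hA hb.le hv hε hs le_rfl x)

lemma hasDerivAt_integral_line (hΦ : AnalyticOnNhd ℂ Φ (tube d ε))
    (hΦb : ∀ z ∈ tube d ε, ‖Φ z‖ ≤ A * Real.exp (-(b * ‖rePart z‖)))
    (hA : 0 ≤ A) (hb : 0 < b) (hv : 2 * ‖v‖ ≤ ε) (hε : 0 < ε) {s₀ : ℂ} (hs₀ : |s₀.im| < 2) :
    HasDerivAt (fun s : ℂ => ∫ x : E d, Φ (toComplex x + s • toComplex v))
      (∫ x : E d, fderiv ℂ Φ (toComplex x + s₀ • toComplex v) (toComplex v)) s₀ := by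
  -- Two steps of length at most R from s₀ stay inside the strip: one to a nearby point s, one to
  -- the Cauchy circle around s.
  set R : ℝ := (2 - |s₀.im|) / 3 with hRdef
  have hR : 0 < R := by rw [hRdef]; linarith
  have him : ∀ s s' : ℂ, ‖s - s₀‖ < R → ‖s' - s‖ ≤ R → |s'.im| < 2 := fun s s' h h' => by
    have h1 := (Complex.abs_im_le_norm (s - s₀)).trans_lt h
    have h2 := (Complex.abs_im_le_norm (s' - s)).trans h'
    rw [Complex.sub_im, abs_lt] at h1
    rw [Complex.sub_im, abs_le] at h2
    have h3 := le_abs_self s₀.im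
    have h4 := neg_abs_le s₀.im
    rw [abs_lt]
    constructor <;> linarith
  have hderiv : ∀ x : E d, ∀ s ∈ Metric.ball s₀ R,
      HasDerivAt (fun s : ℂ => Φ (toComplex x + s • toComplex v))
        (fderiv ℂ Φ (toComplex x + s • toComplex v) (toComplex v)) s := fun x s hs =>
    hasDerivAt_line hΦ hv hε (him s s (by simpa [dist_eq_norm] using hs) (by simpa using hR.le)) x
  refine (hasDerivAt_integral_of_dominated_loc_of_deriv_le (𝕜 := ℂ)
    (F' := fun s x => fderiv ℂ Φ (toComplex x + s • toComplex v) (toComplex v))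
    (bound := fun x => A * Real.exp (b * ((‖s₀‖ + 2 * R) * ‖v‖)) * Real.exp (-(b * ‖x‖)) / R)
    (Metric.ball_mem_nhds s₀ hR) ?_ ?_ ?_ ?_ ?_ ?_).2
  · filter_upwards [isOpen_strip.mem_nhds hs₀] with s hs
    exact (continuous_comp_line hΦ.continuousOn hv hε hs).aestronglyMeasurable
  · exact integrable_line hΦ hΦb hA hb hv hε hs₀
  · exact ((continuous_comp_line hΦ.fderiv.continuousOn hv hε hs₀).clm_apply
      continuous_const).aestronglyMeasurable
  · refine Filter.Eventually.of_forall fun x s hs => ?_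
    have hs' : ‖s - s₀‖ < R := by simpa [dist_eq_norm] using hs
    rw [← (hderiv x s hs).deriv]
    -- Cauchy's estimate bounds the derivative by the decay of Φ itself, uniformly in s.
    refine Complex.norm_deriv_le_of_forall_mem_sphere_norm_le hR ?_ ?_
    · refine DifferentiableOn.diffContOnCl fun s' hs'' => ?_
      rw [closure_ball s hR.ne'] at hs''
      exact (hasDerivAt_line hΦ hv hε (him s s' hs' (by simpa [dist_eq_norm] using hs''))
        x).differentiableAt.differentiableWithinAt
    · intro s' hs''
      have h1 : ‖s' - s‖ = R := by simpa [dist_eq_norm] using hs''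
      refine norm_line_le hΦb hA hb.le hv hε (him s s' hs' h1.le) ?_ x
      calc ‖s'‖ = ‖(s' - s) + (s - s₀) + s₀‖ := by congr 1; ring
        _ ≤ ‖s' - s‖ + ‖s - s₀‖ + ‖s₀‖ := norm_add₃_le
        _ ≤ ‖s₀‖ + 2 * R := by linarith
  · exact ((integrable_exp_neg_norm hb).const_mul _).div_const _
  · exact Filter.Eventually.of_forall hderiv

/-- Shifting the domain of integration into the tube. -/
lemma integral_shift (hΦ : AnalyticOnNhd ℂ Φ (tube d ε))
    (hΦb : ∀ z ∈ tube d ε, ‖Φ z‖ ≤ A * Real.exp (-(b * ‖rePart z‖)))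
    (hA : 0 ≤ A) (hb : 0 < b) (hv : 2 * ‖v‖ ≤ ε) (hε : 0 < ε) :
    ∫ x : E d, Φ (toComplex x) = ∫ x : E d, Φ (toComplex x + Complex.I • toComplex v) := by
  set J : ℂ → ℂ := fun s => ∫ x : E d, Φ (toComplex x + s • toComplex v) with hJ
  -- Real shifts of s are translations of x, under which Lebesgue measure is invariant.
  have htrans : ∀ (s : ℂ) (r : ℝ), J (s + r) = J s := fun s r => by
    rw [hJ]
    simp only
    rw [← integral_add_right_eq_self (fun x : E d => Φ (toComplex x + s • toComplex v)) (r • v)]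
    refine integral_congr_ae (Filter.Eventually.of_forall fun x => ?_)
    simp only [toComplex_add, toComplex_smul, add_smul]
    congr 1
    abel
  -- A holomorphic function that is constant in the real direction has zero complex derivative, so J
  -- is constant on the strip.
  have hder : ∀ s ∈ {s : ℂ | |s.im| < 2}, HasDerivAt J 0 s := fun s hs => by
    have h1 := hasDerivAt_integral_line hΦ hΦb hA hb hv hε hs
    have h2 : HasDerivAt (fun r : ℝ => J (s + r)) _ 0 :=
      (HasDerivAt.comp_const_add s ((0 : ℝ) : ℂ) (by simpa using h1)).comp_ofReal
    simp only [htrans] at h2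
    have h3 := h2.unique (hasDerivAt_const (0 : ℝ) (J s))
    rwa [h3] at h1
  have hconv : IsPreconnected {s : ℂ | |s.im| < 2} := by
    have : {s : ℂ | |s.im| < 2} = Complex.imCLM ⁻¹' Set.Ioo (-2) 2 := by
      ext s; simp [abs_lt]
    rw [this]
    exact ((convex_Ioo (-2 : ℝ) 2).linear_preimage Complex.imCLM.toLinearMap).isPreconnected
  have := isOpen_strip.is_const_of_deriv_eq_zero hconv
    (fun s hs => (hder s hs).differentiableAt.differentiableWithinAt)
    (fun s hs => (hder s hs).deriv) (x := 0) (y := Complex.I) (by simp) (by simp)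
  simpa [hJ] using this

end ContourShift

/-! ### Paley–Wiener: the Fourier transform preserves `C0` -/

section FourierMem

variable {f g : E d → ℂ}

lemma integrable_exp_mul_of_bound {δ K b : ℝ} (hf : AEStronglyMeasurable f)
    (hK : ∀ x, ‖f x‖ ≤ K * Real.exp (-(δ * ‖x‖))) (hb : b < δ) :
    Integrable fun x => Real.exp (b * ‖x‖) * ‖f x‖ := by
  refine ((integrable_exp_neg_norm (sub_pos.2 hb)).const_mul K).mono'
    (AEStronglyMeasurable.mul (by fun_prop) hf.norm) (Filter.Eventually.of_forall fun x => ?_)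
  rw [Real.norm_of_nonneg (by positivity)]
  calc Real.exp (b * ‖x‖) * ‖f x‖
      ≤ Real.exp (b * ‖x‖) * (K * Real.exp (-(δ * ‖x‖))) := by gcongr; exact hK x
    _ = K * (Real.exp (b * ‖x‖) * Real.exp (-(δ * ‖x‖))) := by ring
    _ = K * Real.exp (-((δ - b) * ‖x‖)) := by rw [← Real.exp_add]; ring_nf

/-- Decay and analyticity exchange roles. Half of the decay rate δ gives the tube of width δ/2 for
the transform and the other half keeps the integrals convergent; moving the integration by ε/2 in
the direction opposite to Re ζ produces the factor exp(-(ε/2)‖Re ζ‖). -/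
theorem fourierT_mem_C0 (hf : f ∈ C0 d) : fourierT f ∈ C0 d := by
  have hcont := continuous_of_mem_C0 hf
  obtain ⟨ε, hε, δ, hδ, F, hF, hFf, K', hFK'⟩ := hf
  obtain ⟨K, hK, hFK⟩ : ∃ K : ℝ, 0 ≤ K ∧ ∀ z ∈ tube d ε, ‖F z‖ ≤ K * Real.exp (-(δ * ‖rePart z‖)) :=
    ⟨|K'|, abs_nonneg _, fun z hz => (hFK' z hz).trans (by gcongr; exact le_abs_self K')⟩
  have hfK : ∀ x, ‖f x‖ ≤ K * Real.exp (-(δ * ‖x‖)) := fun x => by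
    simpa [hFf] using hFK _ (toComplex_mem_tube hε x)
  have hδ2 : δ / 2 < δ := by linarith
  refine ⟨δ / 2, by positivity, ε / 2, by positivity, fourierExt f,
    analyticOnNhd_fourierExt hcont.aestronglyMeasurable
      (integrable_exp_mul_of_bound hcont.aestronglyMeasurable hfK hδ2), fourierExt_toComplex f,
    K * ∫ x : E d, Real.exp (-(δ / 2 * ‖x‖)), fun ζ hζ => ?_⟩
  have hζ' : ‖imPart ζ‖ < δ / 2 := hζ
  set Φ : EC d → ℂ := fun z => Complex.exp (-(Complex.I * cpair d ζ z)) * F z with hΦdef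
  have hΦ : AnalyticOnNhd ℂ Φ (tube d ε) := fun z hz => by
    have h1 : AnalyticAt ℂ (fun z => -(Complex.I * cpair d ζ z)) z :=
      (analyticAt_const.mul ((cpair d ζ).analyticAt z)).neg
    exact h1.cexp.mul (hF z hz)
  -- For Re ζ = 0 the inverse is 0 by convention, so v = 0 and no shift takes place.
  set v : E d := (-(ε / 2) * ‖rePart ζ‖⁻¹) • rePart ζ with hvdef
  have hv : 2 * ‖v‖ ≤ ε := by
    rw [hvdef, norm_smul, norm_mul, norm_neg, norm_inv, norm_norm, mul_assoc,
      Real.norm_of_nonneg (by positivity : 0 ≤ ε / 2)]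
    have : ‖rePart ζ‖⁻¹ * ‖rePart ζ‖ ≤ 1 := inv_mul_le_one
    nlinarith
  have hinner : inner ℝ (rePart ζ) v = -(ε / 2) * ‖rePart ζ‖ := by
    rw [hvdef, inner_smul_right, real_inner_self_eq_norm_sq]
    rcases eq_or_ne ‖rePart ζ‖ 0 with h | h
    · simp [h]
    · field_simp
  -- The factor with Im z is kept exact: bounded crudely over the tube it justifies the shift, and
  -- evaluated at Im z = v it is the gain.
  have hbound : ∀ z ∈ tube d ε, ‖Φ z‖ ≤ K * Real.exp (inner ℝ (rePart ζ) (imPart z)) *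
      Real.exp (-(δ / 2 * ‖rePart z‖)) := fun z hz => by
    rw [hΦdef]
    simp only [norm_mul]
    rw [norm_exp_neg_I_mul_cpair, Real.exp_add]
    have h1 : inner ℝ (imPart ζ) (rePart z) ≤ δ / 2 * ‖rePart z‖ :=
      (real_inner_le_norm _ _).trans (by gcongr)
    calc Real.exp (inner ℝ (rePart ζ) (imPart z)) * Real.exp (inner ℝ (imPart ζ) (rePart z)) * ‖F z‖
        ≤ Real.exp (inner ℝ (rePart ζ) (imPart z)) * Real.exp (δ / 2 * ‖rePart z‖) *
          (K * Real.exp (-(δ * ‖rePart z‖))) := by gcongr; exact hFK z hz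
      _ = K * Real.exp (inner ℝ (rePart ζ) (imPart z)) *
          (Real.exp (δ / 2 * ‖rePart z‖) * Real.exp (-(δ * ‖rePart z‖))) := by ring
      _ = _ := by rw [← Real.exp_add]; ring_nf
  have hshift := integral_shift (A := K * Real.exp (‖rePart ζ‖ * ε)) (b := δ / 2) hΦ
    (fun z hz => (hbound z hz).trans (by
      gcongr
      refine (real_inner_le_norm _ _).trans ?_
      gcongr
      exact le_of_lt hz)) (by positivity) (by positivity) hv hε
  have h1 : fourierExt f ζ = ∫ x : E d, Φ (toComplex x + Complex.I • toComplex v) := by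
    rw [← hshift, hΦdef, fourierExt]
    simp only [hFf]
  rw [h1]
  calc ‖∫ x : E d, Φ (toComplex x + Complex.I • toComplex v)‖
      ≤ ∫ x : E d, K * Real.exp (-(ε / 2 * ‖rePart ζ‖)) * Real.exp (-(δ / 2 * ‖x‖)) := by
        refine norm_integral_le_of_norm_le
          ((integrable_exp_neg_norm (by positivity)).const_mul _)
          (Filter.Eventually.of_forall fun x => ?_)
        refine (hbound _ (line_mem_tube hv hε (by simp) x)).trans (le_of_eq ?_)
        simp only [imPart_add, rePart_add, imPart_smul_toComplex, rePart_smul_toComplex,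
          imPart_toComplex, rePart_toComplex, Complex.I_im, Complex.I_re, zero_smul, one_smul,
          zero_add, add_zero, hinner, neg_mul]
    _ = _ := by rw [integral_const_mul]; ring

end FourierMem

/-! ### Fourier inversion on `C0` -/

section Inversion

variable {f g : E d → ℂ}

/-- The inverse Fourier transform `x ↦ (2π)^{-d} ∫ e^{i⟨ξ, x⟩} g(ξ) dξ`. -/
def invFourierT (g : E d → ℂ) (x : E d) : ℂ :=
  ((2 * Real.pi : ℝ) : ℂ)⁻¹ ^ d * ∫ ξ : E d, Complex.exp (Complex.I * (inner ℝ ξ x : ℝ)) * g ξ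

lemma invFourierT_apply (g : E d → ℂ) (x : E d) :
    invFourierT g x = ((2 * Real.pi : ℝ) : ℂ)⁻¹ ^ d * fourierT g (-x) := by
  simp [invFourierT, fourierT, real_inner_comm]

lemma fourierT_eq_fourier (f : E d → ℂ) (ξ : E d) :
    fourierT f ξ = FourierTransform.fourier f ((2 * Real.pi)⁻¹ • ξ) := by
  rw [Real.fourier_eq', fourierT]
  refine integral_congr_ae (Filter.Eventually.of_forall fun x => ?_)
  simp only [inner_smul_right, smul_eq_mul, real_inner_comm]
  congr 2
  push_cast
  field_simp

/-- Inversion for the kernel exp(-2πi⟨ξ, x⟩), transported by the substitution ξ = 2πw, whose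
Jacobian is the factor (2π)^d. -/
theorem invFourierT_fourierT (hc : Continuous f) (hf : Integrable f)
    (hf' : Integrable (fourierT f)) : invFourierT (fourierT f) = f := by
  have hpi : (2 * Real.pi) ≠ 0 := by positivity
  have heq : FourierTransform.fourier f = fun w => fourierT f ((2 * Real.pi) • w) := by
    ext w
    rw [fourierT_eq_fourier, inv_smul_smul₀ hpi]
  have hint : Integrable (FourierTransform.fourier f) := by
    rw [heq]
    exact (integrable_comp_smul_iff volume (fourierT f) hpi).2 hf'
  have hinv := hc.fourierInv_fourier_eq hf hint
  ext x
  conv_rhs => rw [← hinv, Real.fourierInv_eq', heq]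
  have := Measure.integral_comp_smul (volume : Measure (E d))
    (fun ξ => Complex.exp (Complex.I * (inner ℝ ξ x : ℝ)) * fourierT f ξ) (2 * Real.pi)
  rw [invFourierT]
  simp only [finrank_euclideanSpace, Fintype.card_fin] at this
  rw [abs_of_nonneg (by positivity), Complex.real_smul] at this
  push_cast at this ⊢
  rw [inv_pow, ← this]
  refine integral_congr_ae (Filter.Eventually.of_forall fun w => ?_)
  simp only [inner_smul_left, smul_eq_mul, conj_trivial]
  push_cast
  ring_nf

lemma fourierT_comp_neg (f : E d → ℂ) (ξ : E d) :
    fourierT (fun x => f (-x)) ξ = fourierT f (-ξ) := by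
  rw [fourierT, fourierT, ← integral_neg_eq_self]
  simp

lemma fourierT_const_mul (c : ℂ) (f : E d → ℂ) : fourierT (fun x => c * f x) = c • fourierT f := by
  ext ξ
  simp only [fourierT, Pi.smul_apply, smul_eq_mul, ← integral_const_mul]
  exact integral_congr_ae (Filter.Eventually.of_forall fun x => by simp only; ring)

/-- The inverse transform is the transform up to reflection and a constant, and both commute with
the transform. Inversion in one order therefore yields the other. -/
lemma fourierT_invFourierT_eq (g : E d → ℂ) :
    fourierT (invFourierT g) = invFourierT (fourierT g) := by
  ext ξ
  have : invFourierT g = fun x => ((2 * Real.pi : ℝ) : ℂ)⁻¹ ^ d * fourierT g (-x) :=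
    funext (invFourierT_apply g)
  rw [this, fourierT_const_mul, invFourierT_apply, Pi.smul_apply, fourierT_comp_neg, smul_eq_mul]

lemma invFourierT_mem_C0 (hg : g ∈ C0 d) : invFourierT g ∈ C0 d := by
  have : invFourierT g = ((2 * Real.pi : ℝ) : ℂ)⁻¹ ^ d • fun x => fourierT g (-x) :=
    funext (invFourierT_apply g)
  rw [this]
  exact smul_mem_C0 _ (comp_neg_mem_C0 (fourierT_mem_C0 hg))

lemma invFourierT_fourierT_of_mem_C0 (hf : f ∈ C0 d) : invFourierT (fourierT f) = f :=
  invFourierT_fourierT (continuous_of_mem_C0 hf) (integrable_of_mem_C0 hf)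
    (integrable_of_mem_C0 (fourierT_mem_C0 hf))

lemma fourierT_invFourierT_of_mem_C0 (hg : g ∈ C0 d) : fourierT (invFourierT g) = g := by
  rw [fourierT_invFourierT_eq, invFourierT_fourierT_of_mem_C0 hg]

lemma fourierT_injOn_C0 : Set.InjOn fourierT (C0 d) := fun f hf g hg h => by
  rw [← invFourierT_fourierT_of_mem_C0 hf, h, invFourierT_fourierT_of_mem_C0 hg]

lemma integrable_exp_mul (hf : Integrable f) (ξ : E d) :
    Integrable fun x : E d => Complex.exp (-(Complex.I * (inner ℝ ξ x : ℝ))) * f x := by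
  refine hf.bdd_mul (c := 1) (by fun_prop) (Filter.Eventually.of_forall fun x => ?_)
  rw [Complex.norm_exp]
  simp

lemma fourierT_add (hf : Integrable f) (hg : Integrable g) :
    fourierT (f + g) = fourierT f + fourierT g := by
  ext ξ
  simp only [fourierT, Pi.add_apply, mul_add]
  exact integral_add (integrable_exp_mul hf ξ) (integrable_exp_mul hg ξ)

lemma fourierT_smul (c : ℂ) (f : E d → ℂ) : fourierT (c • f) = c • fourierT f :=
  fourierT_const_mul c f

end Inversion

/-! ### Partial derivatives -/

section PartialDerivatives

variable {f g : E d → ℂ} {i j : Fin d}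

lemma contDiff_add (hf : ContDiff ℝ ∞ f) (hg : ContDiff ℝ ∞ g) : ContDiff ℝ ∞ (f + g) := hf.add hg

lemma contDiff_mul (hf : ContDiff ℝ ∞ f) (hg : ContDiff ℝ ∞ g) : ContDiff ℝ ∞ (f * g) := hf.mul hg

lemma contDiff_partialDeriv (hf : ContDiff ℝ ∞ f) (i : Fin d) : ContDiff ℝ ∞ (partialDeriv i f) :=
  (hf.fderiv_right (m := ∞) (by simp)).clm_apply contDiff_const

lemma partialDeriv_comm (hf : ContDiff ℝ ∞ f) (i j : Fin d) :
    partialDeriv i (partialDeriv j f) = partialDeriv j (partialDeriv i f) := by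
  have hd : ∀ x, DifferentiableAt ℝ (fderiv ℝ f) x := fun x =>
    ((hf.fderiv_right (m := ∞) (by simp)).differentiable (by simp)) x
  have key : ∀ (i j : Fin d) (x : E d), partialDeriv i (partialDeriv j f) x =
      fderiv ℝ (fderiv ℝ f) x (EuclideanSpace.single i 1) (EuclideanSpace.single j 1) := by
    intro i j x
    have : partialDeriv j f = fun y => fderiv ℝ f y (EuclideanSpace.single j 1) := rfl
    rw [this, partialDeriv, fderiv_clm_apply (hd x) (differentiableAt_const _)]
    simp
  ext x
  rw [key, key]
  exact ((hf.of_le (m := 2) (WithTop.coe_le_coe.2 le_top)).contDiffAt.isSymmSndFDerivAt (by simp)).eq _ _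

lemma partialDeriv_add (hf : ContDiff ℝ ∞ f) (hg : ContDiff ℝ ∞ g) (i : Fin d) :
    partialDeriv i (f + g) = partialDeriv i f + partialDeriv i g := by
  ext x
  simp only [partialDeriv, Pi.add_apply]
  rw [fderiv_add (hf.differentiable (by simp) x) (hg.differentiable (by simp) x)]
  rfl

lemma partialDeriv_mul (hf : ContDiff ℝ ∞ f) (hg : ContDiff ℝ ∞ g) (i : Fin d) :
    partialDeriv i (f * g) = partialDeriv i f * g + f * partialDeriv i g := by
  ext x
  simp only [Pi.add_apply, Pi.mul_apply, partialDeriv]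
  rw [fderiv_mul (hf.differentiable (by simp) x) (hg.differentiable (by simp) x)]
  simp
  ring

@[simp] lemma partialDeriv_const (c : ℂ) (i : Fin d) : partialDeriv i (fun _ : E d => c) = 0 := by
  ext x
  simp [partialDeriv]

lemma partialDeriv_coord (i j : Fin d) :
    partialDeriv i (fun x : E d => (x j : ℂ)) = fun _ => if i = j then 1 else 0 := by
  ext x
  have h : HasFDerivAt (fun x : E d => (x j : ℂ))
      (Complex.ofRealCLM.comp (EuclideanSpace.proj (𝕜 := ℝ) j : E d →L[ℝ] ℝ)) x :=
    (Complex.ofRealCLM.comp (EuclideanSpace.proj (𝕜 := ℝ) j : E d →L[ℝ] ℝ)).hasFDerivAt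
  rw [partialDeriv, h.fderiv]
  rcases eq_or_ne i j with rfl | hij
  · simp
  · simp [hij, hij.symm]

lemma partialDeriv_congr {x : E d} (h : f =ᶠ[𝓝 x] g) (i : Fin d) :
    partialDeriv i f =ᶠ[𝓝 x] partialDeriv i g :=
  (Filter.EventuallyEq.fderiv (𝕜 := ℝ) h).mono fun y hy => by simp only [partialDeriv, hy]

end PartialDerivatives

/-! ### Multi-index derivatives -/

section MultiDerivatives

variable {f g : E d → ℂ}

/-- By induction on the degree. With `multiDeriv_add_single` it reduces facts about ∂_I to facts
about a single ∂_i. -/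
lemma multiIndex_induction {P : (Fin d →₀ ℕ) → Prop} (h0 : P 0)
    (h : ∀ I i, P I → P (I + Finsupp.single i 1)) (I : Fin d →₀ ℕ) : P I := by
  induction hn : I.degree generalizing I with
  | zero => rwa [(Finsupp.degree_eq_zero_iff I).1 hn]
  | succ n ih =>
    have hI : I ≠ 0 := by rintro rfl; simp at hn
    obtain ⟨i, hi⟩ := Finsupp.ne_iff.1 hI
    have hle : Finsupp.single i 1 ≤ I := by
      rw [Finsupp.single_le_iff]; exact Nat.one_le_iff_ne_zero.2 hi
    rw [← tsub_add_cancel_of_le hle]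
    refine h _ _ (ih _ ?_)
    have := congrArg Finsupp.degree (tsub_add_cancel_of_le hle)
    rw [map_add, hn, Finsupp.degree_single] at this
    omega

lemma contDiff_iterate_partialDeriv (hf : ContDiff ℝ ∞ f) (i : Fin d) (n : ℕ) :
    ContDiff ℝ ∞ ((partialDeriv i)^[n] f) := by
  induction n with
  | zero => exact hf
  | succ n ih => rw [Function.iterate_succ_apply']; exact contDiff_partialDeriv ih i

lemma iterate_partialDeriv_comm (hf : ContDiff ℝ ∞ f) (i j : Fin d) (n : ℕ) :
    (partialDeriv i)^[n] (partialDeriv j f) = partialDeriv j ((partialDeriv i)^[n] f) := by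
  induction n with
  | zero => rfl
  | succ n ih =>
    rw [Function.iterate_succ_apply', Function.iterate_succ_apply', ih,
      partialDeriv_comm (contDiff_iterate_partialDeriv hf i n)]

/-- Iterated partial derivatives along a list of directions. -/
def listDeriv (l : List (Fin d)) (I : Fin d →₀ ℕ) (f : E d → ℂ) : E d → ℂ :=
  l.foldr (fun i g => (partialDeriv i)^[I i] g) f

lemma listDeriv_cons (i : Fin d) (l : List (Fin d)) (I : Fin d →₀ ℕ) (f : E d → ℂ) :
    listDeriv (i :: l) I f = (partialDeriv i)^[I i] (listDeriv l I f) := rfl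

lemma contDiff_listDeriv (hf : ContDiff ℝ ∞ f) (l : List (Fin d)) (I : Fin d →₀ ℕ) :
    ContDiff ℝ ∞ (listDeriv l I f) := by
  induction l with
  | nil => exact hf
  | cons i l ih => exact contDiff_iterate_partialDeriv ih i _

lemma listDeriv_partialDeriv (hf : ContDiff ℝ ∞ f) (l : List (Fin d)) (I : Fin d →₀ ℕ)
    (j : Fin d) : listDeriv l I (partialDeriv j f) = partialDeriv j (listDeriv l I f) := by
  induction l with
  | nil => rfl
  | cons i l ih =>
    rw [listDeriv_cons, listDeriv_cons, ih, iterate_partialDeriv_comm (contDiff_listDeriv hf l I)]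

/-- The additional derivative arises at the only occurrence of j, and moves to the front because
partial derivatives commute. -/
lemma listDeriv_add_single (hf : ContDiff ℝ ∞ f) {l : List (Fin d)} (hl : l.Nodup)
    (I : Fin d →₀ ℕ) (j : Fin d) :
    listDeriv l (I + Finsupp.single j 1) f =
      if j ∈ l then partialDeriv j (listDeriv l I f) else listDeriv l I f := by
  induction l with
  | nil => simp [listDeriv]
  | cons i l ih =>
    rw [List.nodup_cons] at hl
    rw [listDeriv_cons, listDeriv_cons, ih hl.2]
    rcases eq_or_ne i j with rfl | hij
    · simp only [hl.1, if_false, List.mem_cons, true_or, if_true, Finsupp.add_apply,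
        Finsupp.single_eq_same, Function.iterate_succ_apply']
    · simp only [List.mem_cons, hij.symm, false_or, Finsupp.add_apply,
        Finsupp.single_eq_of_ne hij, add_zero]
      split_ifs
      · rw [iterate_partialDeriv_comm (contDiff_listDeriv hf l I)]
      · rfl

lemma contDiff_multiDeriv (hf : ContDiff ℝ ∞ f) (I : Fin d →₀ ℕ) : ContDiff ℝ ∞ (multiDeriv I f) :=
  contDiff_listDeriv hf _ I

lemma multiDeriv_partialDeriv (hf : ContDiff ℝ ∞ f) (I : Fin d →₀ ℕ) (j : Fin d) :
    multiDeriv I (partialDeriv j f) = partialDeriv j (multiDeriv I f) :=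
  listDeriv_partialDeriv hf _ I j

lemma multiDeriv_add_single (hf : ContDiff ℝ ∞ f) (I : Fin d →₀ ℕ) (j : Fin d) :
    multiDeriv (I + Finsupp.single j 1) f = partialDeriv j (multiDeriv I f) := by
  have := listDeriv_add_single hf (List.nodup_finRange d) I j
  rwa [if_pos (List.mem_finRange j)] at this

@[simp] lemma multiDeriv_zero (f : E d → ℂ) : multiDeriv 0 f = f := by
  rw [multiDeriv]
  simp

lemma multiDeriv_add (hf : ContDiff ℝ ∞ f) (hg : ContDiff ℝ ∞ g) (I : Fin d →₀ ℕ) :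
    multiDeriv I (f + g) = multiDeriv I f + multiDeriv I g := by
  induction I using multiIndex_induction with
  | h0 => simp
  | h I i ih =>
    rw [multiDeriv_add_single (contDiff_add hf hg), multiDeriv_add_single hf, multiDeriv_add_single hg, ih,
      partialDeriv_add (contDiff_multiDeriv hf I) (contDiff_multiDeriv hg I)]

lemma multiDeriv_congr {x : E d} (hf : ContDiff ℝ ∞ f) (hg : ContDiff ℝ ∞ g) (h : f =ᶠ[𝓝 x] g)
    (I : Fin d →₀ ℕ) : multiDeriv I f =ᶠ[𝓝 x] multiDeriv I g := by
  induction I using multiIndex_induction with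
  | h0 => simpa using h
  | h I i ih =>
    rw [multiDeriv_add_single hf, multiDeriv_add_single hg]
    exact partialDeriv_congr ih i

end MultiDerivatives

/-! ### Formal Taylor series -/

section TaylorSeries

variable {f g : E d → ℂ}

/-- The formal Taylor series of `f` at `x`. -/
def taylorSeries (f : E d → ℂ) (x : E d) : MvPowerSeries (Fin d) ℂ :=
  fun I => multiDeriv I f x / ((∏ i, (I i).factorial : ℕ) : ℂ)

lemma coeff_taylorSeries (f : E d → ℂ) (x : E d) (I : Fin d →₀ ℕ) :
    MvPowerSeries.coeff I (taylorSeries f x) =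
      multiDeriv I f x / ((∏ i, (I i).factorial : ℕ) : ℂ) := rfl

lemma prod_factorial_ne_zero (I : Fin d →₀ ℕ) : ((∏ i, (I i).factorial : ℕ) : ℂ) ≠ 0 :=
  Nat.cast_ne_zero.2 (Finset.prod_ne_zero_iff.2 fun i _ => (I i).factorial_ne_zero)

lemma prod_factorial_add_single (I : Fin d →₀ ℕ) (i : Fin d) :
    ∏ k, ((I + Finsupp.single i 1 : Fin d →₀ ℕ) k).factorial = (∏ k, (I k).factorial) * (I i + 1) := by
  rw [← Finset.mul_prod_erase _ _ (Finset.mem_univ i), ← Finset.mul_prod_erase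
    Finset.univ (fun k => (I k).factorial) (Finset.mem_univ i)]
  have : ∏ k ∈ Finset.univ.erase i, ((I + Finsupp.single i 1 : Fin d →₀ ℕ) k).factorial
      = ∏ k ∈ Finset.univ.erase i, (I k).factorial :=
    Finset.prod_congr rfl fun k hk => by simp [Finsupp.single_eq_of_ne (Finset.ne_of_mem_erase hk)]
  rw [this]
  simp [Nat.factorial_succ]
  ring

lemma pderiv_taylorSeries (hf : ContDiff ℝ ∞ f) (x : E d) (i : Fin d) :
    MvPowerSeries.pderiv ℂ i (taylorSeries f x) = taylorSeries (partialDeriv i f) x := by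
  ext I
  rw [MvPowerSeries.coeff_pderiv, coeff_taylorSeries, coeff_taylorSeries, multiDeriv_add_single hf,
    multiDeriv_partialDeriv hf, prod_factorial_add_single]
  have h1 := prod_factorial_ne_zero I
  have h2 : ((I i : ℂ) + 1) ≠ 0 := by exact_mod_cast Nat.succ_ne_zero (I i)
  push_cast at h1 ⊢
  field_simp

lemma taylorSeries_add (hf : ContDiff ℝ ∞ f) (hg : ContDiff ℝ ∞ g) (x : E d) :
    taylorSeries (f + g) x = taylorSeries f x + taylorSeries g x := by
  ext I
  simp [coeff_taylorSeries, multiDeriv_add hf hg, add_div]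

/-- Formal partial derivatives of Taylor series are Taylor series of partial derivatives, and both
sides obey the product rule. Coefficients thus agree by induction on I, for all f and g at once. -/
lemma taylorSeries_mul (hf : ContDiff ℝ ∞ f) (hg : ContDiff ℝ ∞ g) (x : E d) :
    taylorSeries (f * g) x = taylorSeries f x * taylorSeries g x := by
  ext I
  induction I using multiIndex_induction generalizing f g with
  | h0 =>
    rw [MvPowerSeries.coeff_zero_eq_constantCoeff_apply, MvPowerSeries.coeff_zero_eq_constantCoeff_apply,
      map_mul]
    simp only [← MvPowerSeries.coeff_zero_eq_constantCoeff_apply, coeff_taylorSeries]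
    simp
  | h I i ih =>
    have h2 : ((I i : ℂ) + 1) ≠ 0 := by exact_mod_cast Nat.succ_ne_zero (I i)
    -- Multiplied by I_i + 1, the coefficient at I + e_i becomes the coefficient at I of the i-th
    -- formal derivative.
    refine mul_right_cancel₀ h2 ?_
    rw [← MvPowerSeries.coeff_pderiv, ← MvPowerSeries.coeff_pderiv, Derivation.leibniz,
      pderiv_taylorSeries (contDiff_mul hf hg), pderiv_taylorSeries hf, pderiv_taylorSeries hg,
      partialDeriv_mul hf hg, taylorSeries_add (contDiff_mul (contDiff_partialDeriv hf i) hg)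
      (contDiff_mul hf (contDiff_partialDeriv hg i)), map_add, map_add, ih (contDiff_partialDeriv hf i) hg,
      ih hf (contDiff_partialDeriv hg i), smul_eq_mul, smul_eq_mul, add_comm,
      mul_comm (taylorSeries g x)]

lemma taylorSeries_const (c : ℂ) (x : E d) :
    taylorSeries (fun _ => c) x = MvPowerSeries.C c := by
  have h0 : ∀ I : Fin d →₀ ℕ, multiDeriv I (0 : E d → ℂ) = 0 := fun I => by
    induction I using multiIndex_induction with
    | h0 => simp
    | h I i ih =>
      rw [multiDeriv_add_single (f := 0) contDiff_const, ih]
      exact partialDeriv_const 0 i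
  refine MvPowerSeries.pderiv.ext (fun i => ?_) ?_
  · rw [pderiv_taylorSeries contDiff_const, partialDeriv_const, MvPowerSeries.pderiv_C]
    ext I
    simp [coeff_taylorSeries, h0]
  · rw [← MvPowerSeries.coeff_zero_eq_constantCoeff_apply, coeff_taylorSeries]
    simp

lemma contDiff_coord (j : Fin d) : ContDiff ℝ ∞ fun x : E d => (x j : ℂ) :=
  (Complex.ofRealCLM.comp (EuclideanSpace.proj (𝕜 := ℝ) j : E d →L[ℝ] ℝ)).contDiff

lemma taylorSeries_coord (j : Fin d) (x : E d) :
    taylorSeries (fun x => (x j : ℂ)) x = MvPowerSeries.C (x j : ℂ) + MvPowerSeries.X j := by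
  refine MvPowerSeries.pderiv.ext (fun i => ?_) ?_
  · rw [pderiv_taylorSeries (contDiff_coord j), partialDeriv_coord, taylorSeries_const, map_add,
      MvPowerSeries.pderiv_C, zero_add]
    rcases eq_or_ne i j with rfl | h
    · simp
    · rw [MvPowerSeries.pderiv_X_of_ne h.symm, if_neg h, map_zero]
  · rw [← MvPowerSeries.coeff_zero_eq_constantCoeff_apply, coeff_taylorSeries]
    simp

lemma multiChoose_mul (I I' : Fin d →₀ ℕ) :
    multiChoose (I + I') I * ((∏ i, (I i).factorial) * ∏ i, (I' i).factorial) =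
      ∏ i, ((I + I') i).factorial := by
  rw [multiChoose, ← Finset.prod_mul_distrib, ← Finset.prod_mul_distrib]
  refine Finset.prod_congr rfl fun i _ => ?_
  rw [Finsupp.add_apply, ← mul_assoc]
  simpa using Nat.choose_mul_factorial_mul_factorial (Nat.le_add_right (I i) (I' i))

/-- The Leibniz rule for multi-index derivatives. -/
lemma multiDeriv_mul (hf : ContDiff ℝ ∞ f) (hg : ContDiff ℝ ∞ g) (J : Fin d →₀ ℕ) :
    multiDeriv J (f * g) = ∑ I ∈ Finset.HasAntidiagonal.antidiagonal J,
      (multiChoose (I.1 + I.2) I.1 : ℂ) • (multiDeriv I.1 f * multiDeriv I.2 g) := by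
  ext x
  -- The Leibniz rule is the coefficient at J of multiplicativity, multiplied by J!.
  have h := congrArg (MvPowerSeries.coeff J) (taylorSeries_mul hf hg x)
  rw [MvPowerSeries.coeff_mul, coeff_taylorSeries, div_eq_iff (prod_factorial_ne_zero J),
    Finset.sum_mul] at h
  rw [h, Finset.sum_apply]
  refine Finset.sum_congr rfl fun I hI => ?_
  rw [Finset.HasAntidiagonal.mem_antidiagonal] at hI
  rw [coeff_taylorSeries, coeff_taylorSeries, ← hI, ← multiChoose_mul]
  have h1 := prod_factorial_ne_zero I.1
  have h2 := prod_factorial_ne_zero I.2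
  push_cast at h1 h2 ⊢
  simp only [Pi.smul_apply, Pi.mul_apply, smul_eq_mul]
  field_simp

end TaylorSeries

/-! ### The ring of symbols and the ring of operators -/

section SymbolRing

variable {p q : E d → ℂ}

/-- Rescaling the variables is a ring homomorphism, so `symbolSeries` inherits additivity and
multiplicativity from Taylor series. -/
lemma symbolSeries_eq (p : E d → ℂ) :
    symbolSeries p = MvPowerSeries.rescale (fun _ => -Complex.I) (taylorSeries p 0) := by
  ext I
  rw [MvPowerSeries.coeff_rescale, coeff_taylorSeries, Finsupp.prod, Finset.prod_pow_eq_pow_sum,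
    ← Finsupp.degree_apply, ← mul_div_assoc]
  rfl

/-- The symbols of the pseudo-differential operators form a ring. -/
def symbolRing (d : ℕ) : Subring (E d → ℂ) where
  carrier := P0 d
  mul_mem' := mul_mem_P0
  one_mem' := const_mem_P0 1
  add_mem' := add_mem_P0
  zero_mem' := const_mem_P0 0
  neg_mem' {f} hf := by
    have h : -f = (fun _ => -1) * f := by ext x; simp
    rw [h]
    exact mul_mem_P0 (const_mem_P0 (-1)) hf

/-- The formal power series of a symbol, as a ring homomorphism. -/
def symbolHom (d : ℕ) : symbolRing d →+* MvPowerSeries (Fin d) ℂ where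
  toFun p := symbolSeries (p : E d → ℂ)
  map_one' := by
    change symbolSeries (fun _ => 1) = 1
    rw [symbolSeries_eq, taylorSeries_const, map_one, map_one]
  map_mul' p q := by
    change symbolSeries ((p : E d → ℂ) * (q : E d → ℂ)) = _
    simp only [symbolSeries_eq, ← map_mul,
      taylorSeries_mul (contDiff_of_mem_P0 p.2) (contDiff_of_mem_P0 q.2)]
  map_zero' := by
    change symbolSeries (fun _ => 0) = 0
    rw [symbolSeries_eq, taylorSeries_const, map_zero, map_zero]
  map_add' p q := by
    change symbolSeries ((p : E d → ℂ) + (q : E d → ℂ)) = _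
    simp only [symbolSeries_eq, ← map_add,
      taylorSeries_add (contDiff_of_mem_P0 p.2) (contDiff_of_mem_P0 q.2)]

@[simp] lemma symbolHom_apply (p : symbolRing d) : symbolHom d p = symbolSeries (p : E d → ℂ) := rfl

/-- The constant symbols. -/
def constSymbol (d : ℕ) : ℂ →+* symbolRing d where
  toFun c := ⟨fun _ => c, const_mem_P0 c⟩
  map_one' := rfl
  map_mul' _ _ := rfl
  map_zero' := rfl
  map_add' _ _ := rfl

/-- The symbol `iξ_j` of `∂_j`. -/
def coordSymbol (j : Fin d) : symbolRing d :=
  constSymbol d Complex.I * ⟨fun ξ => (ξ j : ℂ), coord_mem_P0 j⟩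

lemma symbolHom_constSymbol (c : ℂ) : symbolHom d (constSymbol d c) = MvPowerSeries.C c := by
  change symbolSeries (fun _ => c) = _
  rw [symbolSeries_eq, taylorSeries_const]
  ext I
  rw [MvPowerSeries.coeff_rescale, MvPowerSeries.coeff_C]
  split_ifs with h
  · simp [h]
  · simp

lemma symbolHom_coordSymbol (j : Fin d) : symbolHom d (coordSymbol j) = MvPowerSeries.X j := by
  rw [coordSymbol, map_mul, symbolHom_constSymbol, symbolHom_apply, symbolSeries_eq,
    taylorSeries_coord]
  ext I
  rw [MvPowerSeries.coeff_C_mul, MvPowerSeries.coeff_rescale, PiLp.zero_apply, Complex.ofReal_zero,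
    map_zero, zero_add, MvPowerSeries.coeff_X]
  split_ifs with h
  · simp [h]
  · simp

/-- The symbol of a polynomial differential operator with complex coefficients. -/
def polySymbol (d : ℕ) : MvPolynomial (Fin d) ℂ →+* symbolRing d :=
  MvPolynomial.eval₂Hom (constSymbol d) coordSymbol

lemma symbolHom_polySymbol (q : MvPolynomial (Fin d) ℂ) :
    symbolHom d (polySymbol d q) = (q : MvPowerSeries (Fin d) ℂ) := by
  have : (symbolHom d).comp (polySymbol d) = MvPolynomial.coeToMvPowerSeries.ringHom := by
    refine MvPolynomial.ringHom_ext (fun c => ?_) fun j => ?_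
    · simpa [polySymbol] using symbolHom_constSymbol c
    · simpa [polySymbol] using symbolHom_coordSymbol j
  exact congrArg (fun φ : _ →+* _ => φ q) this

/-- Polynomials already have symbols in `P0`, and `P0` is a ring; so the finite sums of products of
𝒟 produce nothing beyond `D0`. -/
lemma opRing_eq : opRing d = (symbolHom d).range := by
  ext P
  constructor
  · rintro ⟨n, p, q, hp, rfl⟩
    refine sum_mem fun k _ => mul_mem ?_ ?_
    · obtain ⟨s, hs, hsp⟩ := hp k
      exact ⟨⟨s, hs⟩, hsp⟩
    · exact ⟨_, symbolHom_polySymbol _⟩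
  · rintro ⟨p, rfl⟩
    refine ⟨1, fun _ => symbolHom d p, fun _ => 1, fun _ => ⟨p, p.2, rfl⟩, ?_⟩
    simp [polySeries]

end SymbolRing

/-! ### Words versus multi-indices -/

section Multinomial

variable {K : Type*} [Field K] [CharZero K]

/-- The multi-index counting the values of `φ`. -/
def countIndex {n : ℕ} (φ : Fin n → Fin d) : Fin d →₀ ℕ := ∑ k, Finsupp.single (φ k) 1

/-- The multi-indices of degree `n`. -/
def indexOfDegree (d n : ℕ) : Finset (Fin d →₀ ℕ) :=
  (Finset.piAntidiag Finset.univ n).map Finsupp.equivFunOnFinite.symm.toEmbedding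

lemma mem_indexOfDegree {n : ℕ} {I : Fin d →₀ ℕ} : I ∈ indexOfDegree d n ↔ I.degree = n := by
  rw [indexOfDegree, Finset.mem_map_equiv, Finset.mem_piAntidiag, Finsupp.degree_eq_sum]
  simp

/-- Expand (∑ ξ_j X_j)^n once over words and once by the multinomial theorem, then apply the linear
functional sending X^I to H I. -/
lemma sum_prod_mul_countIndex (n : ℕ) (ξ : Fin d → K) (H : (Fin d →₀ ℕ) → K) :
    ∑ φ : Fin n → Fin d, (∏ k, ξ (φ k)) * H (countIndex φ) =
      n.factorial * ∑ I ∈ indexOfDegree d n,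
        (∏ i, ξ i ^ I i) * (H I / ((∏ i, (I i).factorial : ℕ) : K)) := by
  let Λ : MvPolynomial (Fin d) K →ₗ[K] K := (MvPolynomial.basisMonomials (Fin d) K).constr K H
  have hΛ : ∀ (a : K) (I : Fin d →₀ ℕ), Λ (MvPolynomial.C a * MvPolynomial.monomial I 1) = a * H I :=
    fun a I => by
      rw [← MvPolynomial.smul_eq_C_mul, map_smul, smul_eq_mul]
      congr 1
      have := (MvPolynomial.basisMonomials (Fin d) K).constr_basis K H I
      rwa [MvPolynomial.coe_basisMonomials] at this
  have key := congrArg Λ ((Fintype.sum_pow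
    (fun j : Fin d => MvPolynomial.C (ξ j) * MvPolynomial.X (R := K) j) n).symm.trans
    (Finset.sum_pow_eq_sum_piAntidiag Finset.univ _ n))
  rw [map_sum, map_sum] at key
  have h1 : ∀ φ : Fin n → Fin d,
      Λ (∏ k, MvPolynomial.C (ξ (φ k)) * MvPolynomial.X (R := K) (φ k)) =
        (∏ k, ξ (φ k)) * H (countIndex φ) := fun φ => by
    rw [← hΛ, Finset.prod_mul_distrib, countIndex, MvPolynomial.monomial_sum_one, map_prod]
    rfl
  rw [Finset.sum_congr rfl fun φ _ => h1 φ] at key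
  rw [key, indexOfDegree, Finset.sum_map, Finset.mul_sum]
  refine Finset.sum_congr rfl fun I hI => ?_
  have h2 : (∏ i, (MvPolynomial.C (ξ i) * MvPolynomial.X (R := K) i) ^ I i) =
      MvPolynomial.C (∏ i, ξ i ^ I i) *
        MvPolynomial.monomial (Finsupp.equivFunOnFinite.symm I) 1 := by
    rw [MvPolynomial.monomial_eq, Finsupp.prod_fintype _ _ (by simp)]
    simp [mul_pow, Finset.prod_mul_distrib]
  have h3 := Nat.multinomial_spec Finset.univ I
  rw [(Finset.mem_piAntidiag.1 hI).1] at h3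
  have h4 : ((∏ i, (I i).factorial : ℕ) : K) ≠ 0 :=
    Nat.cast_ne_zero.2 (Finset.prod_ne_zero_iff.2 fun i _ => (I i).factorial_ne_zero)
  rw [h2, ← nsmul_eq_mul, map_nsmul, hΛ, nsmul_eq_mul, ← h3]
  simp only [Equiv.coe_toEmbedding, Finsupp.equivFunOnFinite_symm_apply_apply]
  push_cast at h4 ⊢
  field_simp

end Multinomial

/-! ### Unconditional multi-index Taylor expansion -/

section TaylorExpansion

variable {f : E d → ℂ}

lemma iteratedFDeriv_single (hf : ContDiff ℝ ∞ f) {n : ℕ} (φ : Fin n → Fin d) (x : E d) :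
    iteratedFDeriv ℝ n f x (fun k => EuclideanSpace.single (φ k) 1) =
      multiDeriv (countIndex φ) f x := by
  induction n generalizing x with
  | zero => simp [countIndex]
  | succ n ih =>
    have hd : DifferentiableAt ℝ (iteratedFDeriv ℝ n f) x :=
      (hf.differentiable_iteratedFDeriv (by exact_mod_cast WithTop.coe_lt_top _)) x
    have h1 : (fun y => iteratedFDeriv ℝ n f y (fun k => EuclideanSpace.single (φ k.succ) 1)) =
        multiDeriv (countIndex fun k => φ k.succ) f := funext fun y => ih (fun k => φ k.succ) y
    have h2 : countIndex φ = countIndex (fun k => φ k.succ) + Finsupp.single (φ 0) 1 := by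
      rw [countIndex, Fin.sum_univ_succ, add_comm, countIndex]
    rw [iteratedFDeriv_succ_apply_left, h2, multiDeriv_add_single hf, partialDeriv, ← h1,
      fderiv_continuousMultilinear_apply_const hd]
    rfl

/-- The multi-index Taylor expansion of an analytic function, with unconditional convergence. -/
theorem hasSum_taylorSeries (hf : AnalyticOnNhd ℝ f Set.univ) :
    ∃ U ∈ 𝓝 (0 : E d), ∀ ξ ∈ U, HasSum (fun I : Fin d →₀ ℕ =>
      (∏ i, (ξ i : ℂ) ^ I i) * MvPowerSeries.coeff I (taylorSeries f 0)) (f ξ) := by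
  have hcd : ContDiff ℝ ∞ f := hf.contDiff
  obtain ⟨p, r, hp⟩ := hf 0 (Set.mem_univ _)
  -- The multilinear map p n need not be symmetric; the n-th derivative is its sum over all n!
  -- permutations of the arguments.
  have hnorm : ∀ n, ‖iteratedFDeriv ℝ n f 0‖ ≤ n.factorial * ‖p n‖ := fun n => by
    refine ContinuousMultilinearMap.opNorm_le_bound (by positivity) fun v => ?_
    rw [hp.iteratedFDeriv_eq_sum_of_completeSpace]
    refine (norm_sum_le _ _).trans ?_
    calc ∑ σ : Equiv.Perm (Fin n), ‖p n fun i => v (σ i)‖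
        ≤ ∑ σ : Equiv.Perm (Fin n), ‖p n‖ * ∏ i, ‖v i‖ := by
          refine Finset.sum_le_sum fun σ _ => ?_
          rw [← Equiv.prod_comp σ fun i => ‖v i‖]
          exact (p n).le_opNorm _
      _ = n.factorial * ‖p n‖ * ∏ i, ‖v i‖ := by
          simp [Fintype.card_perm, mul_assoc]
  have hmulti : ∀ (n : ℕ) (φ : Fin n → Fin d),
      ‖multiDeriv (countIndex φ) f 0‖ ≤ n.factorial * ‖p n‖ := fun n φ => by
    rw [← iteratedFDeriv_single hcd φ]
    refine ((iteratedFDeriv ℝ n f 0).le_opNorm _).trans ?_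
    simpa using hnorm n
  have hcont : Continuous fun ξ : E d => ∑ i, |ξ i| := by fun_prop
  obtain ⟨s, hs0, hsr⟩ : ∃ s : NNReal, 0 < s ∧ (s : ENNReal) < r := ENNReal.lt_iff_exists_nnreal_btwn.1 hp.r_pos |>.imp
    fun s h => ⟨by simpa using h.1, h.2⟩
  -- The ℓ¹ norm is the right size: the products |ξ_φ(1)| ⋯ |ξ_φ(n)|, summed over all words φ, give
  -- (∑ |ξ_i|)^n, which is at most s^n with s below the radius.
  refine ⟨{ξ | ∑ i, |ξ i| < s} ∩ Metric.eball 0 r, Filter.inter_mem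
    ((isOpen_lt hcont continuous_const).mem_nhds (by simpa using hs0))
    (Metric.eball_mem_nhds _ hp.r_pos), fun ξ hξ => ?_⟩
  obtain ⟨hξs, hξr⟩ := hξ
  set a : (Fin d →₀ ℕ) → ℂ := fun I =>
    (∏ i, (ξ i : ℂ) ^ I i) * MvPowerSeries.coeff I (taylorSeries f 0) with ha
  have hterm : ∀ n : ℕ, ((n.factorial : ℝ)⁻¹ • iteratedFDeriv ℝ n f 0 fun _ => ξ) =
      ∑ I ∈ indexOfDegree d n, a I := fun n => by
    have hξ : ξ = ∑ j, ξ j • (EuclideanSpace.single j (1 : ℝ) : E d) := by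
      ext i
      simp [Pi.single_apply]
    have h1 : (iteratedFDeriv ℝ n f 0 fun _ => ξ) =
        ∑ φ : Fin n → Fin d, (∏ k, (ξ (φ k) : ℂ)) * multiDeriv (countIndex φ) f 0 := by
      conv_lhs => rw [hξ]
      rw [ContinuousMultilinearMap.map_sum]
      refine Finset.sum_congr rfl fun φ _ => ?_
      rw [ContinuousMultilinearMap.map_smul_univ, iteratedFDeriv_single hcd, Complex.real_smul]
      push_cast
      rfl
    rw [h1, sum_prod_mul_countIndex n (fun i => (ξ i : ℂ)) fun I => multiDeriv I f 0,
      Complex.real_smul]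
    have : ((n.factorial : ℕ) : ℂ) ≠ 0 := by exact_mod_cast n.factorial_ne_zero
    push_cast
    rw [inv_mul_cancel_left₀ this]
    simp only [ha, coeff_taylorSeries]
    push_cast
    rfl
  have hterm' : ∀ n : ℕ, ∑ I ∈ indexOfDegree d n, ‖a I‖ ≤ ‖p n‖ * (s : ℝ) ^ n := fun n => by
    have h1 := sum_prod_mul_countIndex n (fun i => |ξ i|) fun I => ‖multiDeriv I f 0‖
    have h2 : ∑ I ∈ indexOfDegree d n, ‖a I‖ = ∑ I ∈ indexOfDegree d n,
        (∏ i, |ξ i| ^ I i) * (‖multiDeriv I f 0‖ / ((∏ i, (I i).factorial : ℕ) : ℝ)) := by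
      refine Finset.sum_congr rfl fun I _ => ?_
      simp only [ha, coeff_taylorSeries, norm_mul, norm_div, norm_prod, norm_pow, Complex.norm_real,
        Complex.norm_natCast, Real.norm_eq_abs]
    rw [← h2] at h1
    have h3 : (n.factorial : ℝ) * ∑ I ∈ indexOfDegree d n, ‖a I‖ ≤
        n.factorial * (‖p n‖ * (s : ℝ) ^ n) := by
      rw [← h1]
      calc ∑ φ : Fin n → Fin d, (∏ k, |ξ (φ k)|) * ‖multiDeriv (countIndex φ) f 0‖
          ≤ ∑ φ : Fin n → Fin d, (∏ k, |ξ (φ k)|) * (n.factorial * ‖p n‖) := by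
            gcongr with φ
            exact hmulti n φ
        _ = (∑ i, |ξ i|) ^ n * (n.factorial * ‖p n‖) := by
            rw [← Finset.sum_mul, Fintype.sum_pow]
        _ ≤ (s : ℝ) ^ n * (n.factorial * ‖p n‖) := by
            gcongr
            exact le_of_lt hξs
        _ = _ := by ring
    exact le_of_mul_le_mul_left h3 (by exact_mod_cast n.factorial_pos)
  have hfiber : ∀ {X : Type} [AddCommMonoid X] [TopologicalSpace X] (b : (Fin d →₀ ℕ) → X) (n : ℕ),
      HasSum (fun I : {I : Fin d →₀ ℕ // I.degree = n} => b I) (∑ I ∈ indexOfDegree d n, b I) :=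
    fun b n =>
      (Equiv.hasSum_iff (Equiv.subtypeEquivRight fun I => mem_indexOfDegree.symm :
        {I : Fin d →₀ ℕ // I.degree = n} ≃ {I // I ∈ indexOfDegree d n})).2
          ((indexOfDegree d n).hasSum b)
  let e := Equiv.sigmaFiberEquiv (Finsupp.degree : (Fin d →₀ ℕ) → ℕ)
  have hsum : Summable a := by
    refine Summable.of_norm ?_
    rw [← e.summable_iff]
    refine (summable_sigma_of_nonneg (f := (fun I => ‖a I‖) ∘ e) fun _ => norm_nonneg _).2 ⟨fun n => (hfiber (fun I => ‖a I‖) n).summable, ?_⟩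
    refine Summable.of_nonneg_of_le (fun n => tsum_nonneg fun _ => norm_nonneg _) (fun n => ?_)
      (p.summable_norm_mul_pow (hsr.trans_le hp.r_le))
    exact ((hfiber (fun I => ‖a I‖) n).tsum_eq).trans_le (hterm' n)
  -- Having absolute summability, group by degree: the homogeneous parts are the terms of the
  -- one-variable expansion `h2`, so the two sums coincide.
  have h1 := (e.hasSum_iff.2 hsum.hasSum).sigma fun n => hfiber a n
  have h2 := hp.hasSum_iteratedFDeriv hξr
  rw [zero_add] at h2
  simp only [hterm] at h2
  rw [h2.unique h1]
  exact hsum.hasSum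

end TaylorExpansion

/-! ### Derivatives and power series in Fourier space -/

section FourierDerivatives

variable {f g : E d → ℂ}

lemma integrable_norm_mul_of_mem_C0 (hg : g ∈ C0 d) : Integrable fun x => ‖x‖ * ‖g x‖ := by
  have hc := continuous_of_mem_C0 hg
  obtain ⟨δ, hδ, K, hK⟩ := bound_of_mem_C0 hg
  have h := integrable_exp_mul_of_bound hc.aestronglyMeasurable hK (by linarith : δ / 2 < δ)
  refine (h.const_mul (2 / δ)).mono' (by fun_prop) (Filter.Eventually.of_forall fun x => ?_)
  rw [Real.norm_of_nonneg (by positivity), ← mul_assoc]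
  gcongr
  have := Real.add_one_le_exp (δ / 2 * ‖x‖)
  rw [div_mul_eq_mul_div, le_div_iff₀ hδ]
  linarith

lemma coordSymbol_coe (j : Fin d) (ξ : E d) :
    (coordSymbol j : E d → ℂ) ξ = Complex.I * (ξ j : ℂ) := rfl

/-- Differentiation under the integral sign; here `coordSymbol j` stands for the function ix_j of
the position variable. -/
lemma partialDeriv_fourierT (hg : g ∈ C0 d) (j : Fin d) :
    partialDeriv j (fourierT g) = -fourierT ((coordSymbol j : E d → ℂ) * g) := by
  have hint := integrable_of_mem_C0 hg
  have hint' := integrable_norm_mul_of_mem_C0 hg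
  ext ξ
  have h1 : fourierT g = fun ξ => FourierTransform.fourier g ((2 * Real.pi)⁻¹ • ξ) :=
    funext (fourierT_eq_fourier g)
  have h2 := (Real.hasFDerivAt_fourier hint hint' ((2 * Real.pi)⁻¹ • ξ)).comp ξ
    ((hasFDerivAt_id (𝕜 := ℝ) ξ).const_smul (2 * Real.pi)⁻¹)
  have h3 : fderiv ℝ (fourierT g) ξ =
      (FourierTransform.fourier (VectorFourier.fourierSMulRight (innerSL ℝ) g)
        ((2 * Real.pi)⁻¹ • ξ)).comp ((2 * Real.pi)⁻¹ • ContinuousLinearMap.id ℝ (E d)) := by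
    rw [h1]
    exact h2.fderiv
  have hsm : Integrable (VectorFourier.fourierSMulRight (innerSL ℝ) g) := by
    refine (hint'.const_mul (2 * Real.pi)).mono'
      hint.1.fourierSMulRight (Filter.Eventually.of_forall fun x => ?_)
    refine (VectorFourier.norm_fourierSMulRight_le (innerSL ℝ) g x).trans ?_
    have : ‖innerSL ℝ (E := E d)‖ ≤ 1 := norm_innerSL_le ℝ
    calc 2 * Real.pi * ‖innerSL ℝ (E := E d)‖ * ‖x‖ * ‖g x‖
        ≤ 2 * Real.pi * 1 * ‖x‖ * ‖g x‖ := by gcongr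
      _ = _ := by ring
  rw [partialDeriv, h3, ContinuousLinearMap.comp_apply,
    Real.fourier_continuousLinearMap_apply hsm, Pi.neg_apply, fourierT_eq_fourier,
    Real.fourier_eq', Real.fourier_eq', ← integral_neg]
  refine integral_congr_ae (Filter.Eventually.of_forall fun x => ?_)
  have hπ : (Real.pi : ℂ) ≠ 0 := by exact_mod_cast Real.pi_ne_zero
  have hj : innerSL ℝ x (EuclideanSpace.single j 1) = x j := by
    rw [innerSL_apply_apply, EuclideanSpace.inner_single_right]
    simp
  simp [coordSymbol_coe, hj]
  field_simp

lemma differentiable_fourierT (hg : g ∈ C0 d) : Differentiable ℝ (fourierT g) :=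
  (contDiff_of_mem_C0 (fourierT_mem_C0 hg)).differentiable (by simp)

lemma partialDeriv_invFourierT (hg : g ∈ C0 d) (j : Fin d) :
    partialDeriv j (invFourierT g) = invFourierT ((coordSymbol j : E d → ℂ) * g) := by
  ext x
  have h1 : invFourierT g = fun x => ((2 * Real.pi : ℝ) : ℂ)⁻¹ ^ d * fourierT g (-x) :=
    funext (invFourierT_apply g)
  have h2 : HasFDerivAt (fun x => fourierT g (-x))
      ((fderiv ℝ (fourierT g) (-x)).comp (-ContinuousLinearMap.id ℝ (E d))) x :=
    (differentiable_fourierT hg (-x)).hasFDerivAt.comp x (hasFDerivAt_id x).neg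
  have h3 := congrFun (partialDeriv_fourierT hg j) (-x)
  rw [partialDeriv, Pi.neg_apply] at h3
  rw [partialDeriv, h1, (h2.const_mul _).fderiv, invFourierT_apply]
  simp [h3]

/-- No estimate on derivatives is needed: in Fourier space this is multiplication by a symbol. -/
lemma partialDeriv_mem_C0 (hf : f ∈ C0 d) (j : Fin d) : partialDeriv j f ∈ C0 d := by
  rw [← invFourierT_fourierT_of_mem_C0 hf, partialDeriv_invFourierT (fourierT_mem_C0 hf)]
  exact invFourierT_mem_C0 (mul_mem_C0 (coordSymbol j).2 (fourierT_mem_C0 hf))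

lemma fourierT_partialDeriv (hf : f ∈ C0 d) (j : Fin d) :
    fourierT (partialDeriv j f) = (coordSymbol j : E d → ℂ) * fourierT f := by
  conv_lhs => rw [← invFourierT_fourierT_of_mem_C0 hf, partialDeriv_invFourierT (fourierT_mem_C0 hf)]
  exact fourierT_invFourierT_of_mem_C0 (mul_mem_C0 (coordSymbol j).2 (fourierT_mem_C0 hf))

/-- The symbol of `∂_I`. -/
def monoSymbol (I : Fin d →₀ ℕ) : symbolRing d := ∏ i, coordSymbol i ^ I i

lemma monoSymbol_zero : monoSymbol (0 : Fin d →₀ ℕ) = 1 := by simp [monoSymbol]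

lemma monoSymbol_add_single (I : Fin d →₀ ℕ) (j : Fin d) :
    monoSymbol (I + Finsupp.single j 1) = coordSymbol j * monoSymbol I := by
  simp only [monoSymbol, Finsupp.add_apply, pow_add, Finset.prod_mul_distrib]
  rw [mul_comm, Finset.prod_eq_single j (fun i _ hij => by simp [Finsupp.single_eq_of_ne hij])
    (by simp)]
  simp

lemma monoSymbol_coe (I : Fin d →₀ ℕ) (ξ : E d) :
    (monoSymbol I : E d → ℂ) ξ = Complex.I ^ I.degree * ∏ i, (ξ i : ℂ) ^ I i := by
  induction I using multiIndex_induction with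
  | h0 => simp [monoSymbol_zero]
  | h I j ih =>
    rw [monoSymbol_add_single]
    change (coordSymbol j : E d → ℂ) ξ * (monoSymbol I : E d → ℂ) ξ = _
    rw [ih, coordSymbol_coe, map_add, Finsupp.degree_single, pow_succ]
    simp only [Finsupp.add_apply, pow_add, Finset.prod_mul_distrib]
    rw [Finset.prod_eq_single (f := fun i => (ξ i : ℂ) ^ (Finsupp.single j 1 : Fin d →₀ ℕ) i) j
      (fun i _ hij => by simp [Finsupp.single_eq_of_ne hij]) (by simp)]
    simp
    ring

lemma multiDeriv_mem_C0_and_fourierT (hf : f ∈ C0 d) (I : Fin d →₀ ℕ) :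
    multiDeriv I f ∈ C0 d ∧
      fourierT (multiDeriv I f) = (monoSymbol I : E d → ℂ) * fourierT f := by
  induction I using multiIndex_induction with
  | h0 => simpa [monoSymbol_zero] using hf
  | h I j ih =>
    rw [multiDeriv_add_single (contDiff_of_mem_C0 hf), fourierT_partialDeriv ih.1, ih.2,
      monoSymbol_add_single, ← mul_assoc]
    exact ⟨partialDeriv_mem_C0 ih.1 j, rfl⟩

lemma multiDeriv_mem_C0 (hf : f ∈ C0 d) (I : Fin d →₀ ℕ) : multiDeriv I f ∈ C0 d :=
  (multiDeriv_mem_C0_and_fourierT hf I).1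

lemma fourierT_multiDeriv (hf : f ∈ C0 d) (I : Fin d →₀ ℕ) :
    fourierT (multiDeriv I f) = (monoSymbol I : E d → ℂ) * fourierT f :=
  (multiDeriv_mem_C0_and_fourierT hf I).2

theorem funcSpace_eq_C0 : funcSpace d = C0 d := by
  ext f
  refine ⟨fun h => by simpa using h.2 0, fun h => ⟨contDiff_of_mem_C0 h, multiDeriv_mem_C0 h⟩⟩

lemma coeff_symbolSeries (p : E d → ℂ) (I : Fin d →₀ ℕ) :
    MvPowerSeries.coeff I (symbolSeries p) =
      (-Complex.I) ^ I.degree * MvPowerSeries.coeff I (taylorSeries p 0) := by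
  rw [coeff_taylorSeries, ← mul_div_assoc]
  rfl

/-- A symbol is near the origin the sum of its power series. -/
theorem hasSum_symbolSeries {p : E d → ℂ} (hp : p ∈ P0 d) :
    ∃ U ∈ 𝓝 (0 : E d), ∀ ξ ∈ U, HasSum (fun I : Fin d →₀ ℕ =>
      MvPowerSeries.coeff I (symbolSeries p) * (monoSymbol I : E d → ℂ) ξ) (p ξ) := by
  obtain ⟨U, hU, h⟩ := hasSum_taylorSeries (analyticOnNhd_of_mem_P0 hp)
  refine ⟨U, hU, fun ξ hξ => (h ξ hξ).congr_fun fun I => ?_⟩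
  rw [coeff_symbolSeries, monoSymbol_coe]
  have : (-Complex.I) ^ I.degree * Complex.I ^ I.degree = 1 := by
    rw [← mul_pow]; simp
  linear_combination (MvPowerSeries.coeff I (taylorSeries p 0) * ∏ i, (ξ i : ℂ) ^ I i) * this

/-- A symbol with zero series vanishes near 0, hence everywhere by analyticity. This makes the
action of a power series in 𝒟 well defined. -/
lemma symbolHom_injective : Function.Injective (symbolHom d) := by
  rw [injective_iff_map_eq_zero]
  intro p hp
  obtain ⟨U, hU, h⟩ := hasSum_symbolSeries p.2
  have h0 : ∀ ξ ∈ U, (p : E d → ℂ) ξ = 0 := fun ξ hξ => by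
    refine (h ξ hξ).unique ?_
    rw [← symbolHom_apply, hp]
    simp
  exact Subtype.ext ((analyticOnNhd_of_mem_P0 p.2).eq_of_eventuallyEq
    (g := 0) analyticOnNhd_const (Filter.eventually_of_mem hU h0))

end FourierDerivatives

/-! ### Convolution -/

section Convolution

variable {f g : E d → ℂ}

lemma bddAbove_of_mem_C0 (hg : g ∈ C0 d) : BddAbove (Set.range fun x => ‖g x‖) := by
  obtain ⟨δ, hδ, K, hK⟩ := bound_of_mem_C0 hg
  refine ⟨|K|, ?_⟩
  rintro _ ⟨x, rfl⟩
  refine (hK x).trans ?_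
  have h1 : Real.exp (-(δ * ‖x‖)) ≤ 1 := Real.exp_le_one_iff.2 (by
    have := norm_nonneg x; nlinarith)
  calc K * Real.exp (-(δ * ‖x‖)) ≤ |K| * Real.exp (-(δ * ‖x‖)) := by gcongr; exact le_abs_self K
    _ ≤ |K| * 1 := by gcongr
    _ = |K| := mul_one _

lemma convolutionExists_of_mem_C0 (hf : f ∈ C0 d) (hg : g ∈ C0 d) :
    ConvolutionExists f g (ContinuousLinearMap.mul ℂ ℂ) volume := fun _ =>
  BddAbove.convolutionExistsAt (s := Set.univ) _
    ((bddAbove_of_mem_C0 hg).mono (Set.image_subset_range _ _)) MeasurableSet.univ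
    (Set.subset_univ _) (integrable_of_mem_C0 hf).integrableOn
    (continuous_of_mem_C0 hg).aestronglyMeasurable

/-- Convolution is multiplication in Fourier space. -/
lemma convolution_eq_invFourierT (hf : f ∈ C0 d) (hg : g ∈ C0 d) :
    convolution f g (ContinuousLinearMap.mul ℂ ℂ) volume =
      invFourierT (fourierT f * fourierT g) := by
  have hF : fourierT (convolution f g (ContinuousLinearMap.mul ℂ ℂ) volume) =
      fourierT f * fourierT g := by
    ext ξ
    rw [Pi.mul_apply, fourierT_eq_fourier, fourierT_eq_fourier, fourierT_eq_fourier]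
    exact Real.fourier_mul_convolution_eq (integrable_of_mem_C0 hf) (integrable_of_mem_C0 hg) _
  rw [← hF, invFourierT_fourierT]
  · exact BddAbove.continuous_convolution_right_of_integrable _ (bddAbove_of_mem_C0 hg)
      (integrable_of_mem_C0 hf) (continuous_of_mem_C0 hg)
  · exact (integrable_of_mem_C0 hf).integrable_convolution _ (integrable_of_mem_C0 hg)
  · rw [hF]
    exact integrable_of_mem_C0
      (mul_mem_C0 (C0_subset_P0 (fourierT_mem_C0 hf)) (fourierT_mem_C0 hg))

end Convolution

/-! ### Common divisors: products of 1/cosh -/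

section Sech

variable {a : ℝ}

lemma norm_cosh_le (w : ℂ) : ‖Complex.cosh w‖ ≤ Real.exp |w.re| := by
  rw [Complex.cosh, norm_div, Complex.norm_ofNat, div_le_iff₀ two_pos]
  refine (norm_add_le _ _).trans ?_
  rw [Complex.norm_exp, Complex.norm_exp, Complex.neg_re, mul_two]
  gcongr
  exacts [le_abs_self _, neg_le_abs _]

/-- The real part of cosh(u + iv) is cosh u cos v, and cos v ≥ 1 - v²/2 ≥ 1/2 for |v| ≤ 1. -/
lemma exp_abs_re_le_norm_cosh {w : ℂ} (hw : |w.im| ≤ 1) :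
    Real.exp |w.re| / 4 ≤ ‖Complex.cosh w‖ := by
  have h1 : (Complex.cosh w).re = Real.cosh w.re * Real.cos w.im := by
    conv_lhs => rw [← Complex.re_add_im w, Complex.cosh_add, Complex.cosh_mul_I, Complex.sinh_mul_I]
    simp [← Complex.ofReal_cosh, ← Complex.ofReal_sinh, ← Complex.ofReal_cos, ← Complex.ofReal_sin]
  have h2 : 1 / 2 ≤ Real.cos w.im := by
    have := Real.one_sub_sq_div_two_le_cos (x := w.im)
    have h3 : w.im ^ 2 ≤ 1 := (sq_le_one_iff_abs_le_one _).2 hw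
    linarith
  have h4 : Real.exp |w.re| / 2 ≤ Real.cosh w.re := by
    rw [← Real.cosh_abs, Real.cosh_eq]
    have := Real.exp_pos (-|w.re|)
    linarith
  refine le_trans ?_ ((le_abs_self _).trans (Complex.abs_re_le_norm _))
  rw [h1]
  have := Real.exp_pos |w.re|
  nlinarith

/-- The function `∏ cosh (a z_j)`. -/
def coshProd (a : ℝ) (z : EC d) : ℂ := ∏ j, Complex.cosh (a * z j)

/-- The function `∏ cosh (a x_j)⁻¹`. -/
def sechProd (d : ℕ) (a : ℝ) (x : E d) : ℂ := (coshProd a (toComplex x))⁻¹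

lemma analyticAt_coshProd (a : ℝ) (z : EC d) : AnalyticAt ℂ (coshProd a) z :=
  Finset.analyticAt_fun_prod _ fun j _ =>
    ((Complex.differentiable_cosh.analyticAt _).comp
      (analyticAt_const.mul (analyticAt_apply j z)))

lemma norm_coshProd_le (ha : 0 ≤ a) (z : EC d) :
    ‖coshProd a z‖ ≤ Real.exp (a * (d * ‖rePart z‖)) := by
  rw [coshProd, norm_prod]
  calc ∏ j, ‖Complex.cosh (a * z j)‖ ≤ ∏ _j : Fin d, Real.exp (a * ‖rePart z‖) := by
        gcongr with j
        refine (norm_cosh_le _).trans ?_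
        gcongr
        have : |(z j).re| ≤ ‖rePart z‖ := by simpa using PiLp.norm_apply_le (rePart z) j
        simpa [abs_mul, abs_of_nonneg ha] using mul_le_mul_of_nonneg_left this ha
    _ = _ := by
        rw [Finset.prod_const, ← Real.exp_nat_mul]
        simp
        ring

lemma norm_le_sum_abs (x : E d) : ‖x‖ ≤ ∑ j, |x j| := by
  have hx : x = ∑ j, x j • (EuclideanSpace.single j (1 : ℝ) : E d) := by
    ext i
    simp [Pi.single_apply]
  conv_lhs => rw [hx]
  refine (norm_sum_le _ _).trans (le_of_eq (Finset.sum_congr rfl fun j _ => ?_))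
  simp [norm_smul]

lemma exp_le_norm_coshProd (ha : 0 < a) {z : EC d} (hz : z ∈ tube d a⁻¹) :
    Real.exp (a * ‖rePart z‖) / 4 ^ d ≤ ‖coshProd a z‖ := by
  rw [coshProd, norm_prod]
  calc Real.exp (a * ‖rePart z‖) / 4 ^ d ≤ Real.exp (∑ j, a * |(z j).re|) / 4 ^ d := by
        gcongr
        rw [← Finset.mul_sum]
        gcongr
        exact norm_le_sum_abs (rePart z)
    _ = ∏ j : Fin d, (Real.exp (a * |(z j).re|) / 4) := by
        rw [Finset.prod_div_distrib, Real.exp_sum]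
        simp
    _ ≤ _ := by
        gcongr with j
        have h1 : |(z j).im| ≤ ‖imPart z‖ := by simpa using PiLp.norm_apply_le (imPart z) j
        have h2 : |(a * z j).im| ≤ 1 := by
          have : ‖imPart z‖ < a⁻¹ := hz
          rw [Complex.im_ofReal_mul, abs_mul, abs_of_pos ha]
          calc a * |(z j).im| ≤ a * a⁻¹ := by gcongr; linarith
            _ = 1 := mul_inv_cancel₀ ha.ne'
        have h3 := exp_abs_re_le_norm_cosh h2
        rwa [Complex.re_ofReal_mul, abs_mul, abs_of_pos ha] at h3

lemma coshProd_ne_zero (ha : 0 < a) {z : EC d} (hz : z ∈ tube d a⁻¹) : coshProd a z ≠ 0 :=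
  norm_pos_iff.1 (lt_of_lt_of_le (by positivity) (exp_le_norm_coshProd ha hz))

lemma sechProd_ne_zero (ha : 0 < a) (x : E d) : sechProd d a x ≠ 0 :=
  inv_ne_zero (coshProd_ne_zero ha (toComplex_mem_tube (inv_pos.2 ha) x))

lemma sechProd_mem_C0 (ha : 0 < a) : sechProd d a ∈ C0 d := by
  refine ⟨a⁻¹, inv_pos.2 ha, a, ha, fun z => (coshProd a z)⁻¹,
    fun z hz => (analyticAt_coshProd a z).inv (coshProd_ne_zero ha hz), fun x => rfl, 4 ^ d,
    fun z hz => ?_⟩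
  rw [norm_inv, Real.exp_neg, ← div_eq_mul_inv, ← inv_div]
  exact inv_anti₀ (by positivity) (exp_le_norm_coshProd ha hz)

/-- A function with exponential decay is divisible by `sechProd a` for all small `a`. -/
lemma exists_div_sechProd {h : E d → ℂ} (hh : h ∈ C0 d) :
    ∃ a₀ > 0, ∀ a, 0 < a → a ≤ a₀ → (sechProd d a)⁻¹ * h ∈ C0 d := by
  obtain ⟨ε, hε, δ, hδ, H, hH, hHh, K, hK⟩ := hh
  -- The product of d factors cosh grows at rate at most ad, which must cost no more than δ/2; d + 1
  -- in place of d admits d = 0.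
  refine ⟨δ / (2 * (d + 1)), by positivity, fun a ha haδ => ?_⟩
  have hδ' : a * d ≤ δ / 2 := by
    rw [le_div_iff₀ (by positivity)] at haδ
    nlinarith
  refine ⟨ε, hε, δ / 2, by positivity, coshProd a * H,
    fun z hz => (analyticAt_coshProd a z).mul (hH z hz), fun x => ?_, K, fun z hz => ?_⟩
  · simp [sechProd, hHh]
  · rw [Pi.mul_apply, norm_mul]
    have hK0 : 0 ≤ K := nonneg_of_mul_nonneg_left ((norm_nonneg _).trans (hK z hz)) (Real.exp_pos _)
    calc ‖coshProd a z‖ * ‖H z‖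
        ≤ Real.exp (a * (d * ‖rePart z‖)) * (K * Real.exp (-(δ * ‖rePart z‖))) := by
          gcongr
          exacts [norm_coshProd_le ha.le z, hK z hz]
      _ = K * Real.exp (a * d * ‖rePart z‖ - δ * ‖rePart z‖) := by
          rw [mul_left_comm, ← Real.exp_add]; ring_nf
      _ ≤ K * Real.exp (-(δ / 2 * ‖rePart z‖)) := by
          gcongr
          nlinarith [norm_nonneg (rePart z)]

lemma norm_sechProd_le_one (a : ℝ) (x : E d) : ‖sechProd d a x‖ ≤ 1 := by
  rw [sechProd, norm_inv, coshProd, norm_prod, ← Finset.prod_inv_distrib]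
  refine Finset.prod_le_one (fun j _ => by positivity) fun j _ => inv_le_one_of_one_le₀ ?_
  rw [toComplex_apply, ← Complex.ofReal_mul, ← Complex.ofReal_cosh, Complex.norm_real,
    Real.norm_of_nonneg (Real.cosh_pos _).le]
  exact Real.one_le_cosh _

lemma tendsto_sechProd (x : E d) :
    Filter.Tendsto (fun a => sechProd d a x) (𝓝[>] 0) (𝓝 1) := by
  have h : ContinuousAt (fun a : ℝ => coshProd a (toComplex x)) 0 := by
    unfold coshProd
    fun_prop
  have h0 : coshProd 0 (toComplex x) = 1 := by simp [coshProd]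
  have := (h.inv₀ (by rw [h0]; exact one_ne_zero)).tendsto
  simp only [Pi.inv_apply, h0, inv_one] at this
  exact this.mono_left nhdsWithin_le_nhds

end Sech

/-! ### Fourier transforms of compactly supported functions -/

section CompactSupport

variable {φ : E d → ℂ}

lemma fourierT_partialDeriv_of_hasCompactSupport (hφ : ContDiff ℝ ∞ φ) (hc : HasCompactSupport φ)
    (j : Fin d) : fourierT (partialDeriv j φ) = (coordSymbol j : E d → ℂ) * fourierT φ := by
  have hint' : Integrable (fderiv ℝ φ) :=
    (hφ.continuous_fderiv (by simp)).integrable_of_hasCompactSupport (hc.fderiv ℝ)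
  have h := Real.fourier_fderiv (hφ.continuous.integrable_of_hasCompactSupport hc)
    (hφ.differentiable (by simp)) hint'
  ext ξ
  have h1 := congrArg (fun L : E d →L[ℝ] ℂ => L (EuclideanSpace.single j 1))
    (congrFun h ((2 * Real.pi)⁻¹ • ξ))
  rw [Real.fourier_continuousLinearMap_apply hint'] at h1
  rw [fourierT_eq_fourier, Pi.mul_apply, fourierT_eq_fourier]
  refine Eq.trans h1 ?_
  have hπ : (Real.pi : ℂ) ≠ 0 := by exact_mod_cast Real.pi_ne_zero
  have hj : innerSL ℝ ξ (EuclideanSpace.single j 1) = ξ j := by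
    rw [innerSL_apply_apply, EuclideanSpace.inner_single_right]
    simp
  simp [coordSymbol_coe, hj]
  field_simp

lemma integrable_fourierT_of_hasCompactSupport (hφ : ContDiff ℝ ∞ φ) (hc : HasCompactSupport φ) :
    Integrable (fourierT φ) := by
  have h : Integrable (FourierTransform.fourier φ) := by
    have := (FourierTransform.fourier (hc.toSchwartzMap hφ)).integrable (μ := volume)
    rwa [SchwartzMap.fourier_coe] at this
  have h2 : fourierT φ = fun ξ => FourierTransform.fourier φ ((2 * Real.pi)⁻¹ • ξ) :=
    funext (fourierT_eq_fourier φ)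
  rw [h2]
  exact (integrable_comp_smul_iff volume _ (by positivity)).2 h

/-- All exponential moments of φ are finite, so its transform is analytic and bounded on any tube;
width 1 is an arbitrary choice. -/
lemma fourierT_mem_P0_of_hasCompactSupport (hφ : Continuous φ) (hc : HasCompactSupport φ) :
    fourierT φ ∈ P0 d := by
  have hint : Integrable fun x => Real.exp (1 * ‖x‖) * ‖φ x‖ :=
    Continuous.integrable_of_hasCompactSupport (by fun_prop) hc.norm.mul_left
  refine ⟨1, one_pos, fourierExt φ, analyticOnNhd_fourierExt hφ.aestronglyMeasurable hint,
    fourierExt_toComplex φ, fun δ hδ => ⟨(∫ x, Real.exp (1 * ‖x‖) * ‖φ x‖) + 1, ?_, fun z hz => ?_⟩⟩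
  · have : 0 ≤ ∫ x, Real.exp (1 * ‖x‖) * ‖φ x‖ := integral_nonneg fun x => by positivity
    positivity
  · have h1 := norm_fourierExt_le hz hint
    have h2 : 1 ≤ Real.exp (δ * ‖rePart z‖) := Real.one_le_exp (by positivity)
    nlinarith [norm_nonneg (fourierExt φ z)]

lemma multiDeriv_of_hasCompactSupport (hφ : ContDiff ℝ ∞ φ) (hc : HasCompactSupport φ)
    (I : Fin d →₀ ℕ) : HasCompactSupport (multiDeriv I φ) ∧
      fourierT (multiDeriv I φ) = (monoSymbol I : E d → ℂ) * fourierT φ := by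
  induction I using multiIndex_induction with
  | h0 => simpa [monoSymbol_zero] using hc
  | h I j ih =>
    rw [multiDeriv_add_single hφ, fourierT_partialDeriv_of_hasCompactSupport
      (contDiff_multiDeriv hφ I) ih.1, ih.2, monoSymbol_add_single, ← mul_assoc]
    exact ⟨ih.1.fderiv_apply ℝ _, rfl⟩

end CompactSupport

/-! ### Density in the smooth functions -/

section Density

variable {φ : E d → ℂ}

lemma norm_invFourierT_sub_le {F G : E d → ℂ} (hF : Integrable F) (hG : Integrable G) (x : E d) :
    ‖invFourierT F x - invFourierT G x‖ ≤
      ‖((2 * Real.pi : ℝ) : ℂ)⁻¹ ^ d‖ * ∫ ξ, ‖F ξ - G ξ‖ := by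
  have h : ∀ {H : E d → ℂ}, Integrable H →
      Integrable fun ξ : E d => Complex.exp (Complex.I * (inner ℝ ξ x : ℝ)) * H ξ := fun hH => by
    refine hH.bdd_mul (c := 1) (by fun_prop) (Filter.Eventually.of_forall fun ξ => ?_)
    rw [Complex.norm_exp]
    simp
  rw [invFourierT, invFourierT, ← mul_sub, norm_mul, ← integral_sub (h hF) (h hG)]
  gcongr
  refine (norm_integral_le_integral_norm _).trans (le_of_eq ?_)
  refine integral_congr_ae (Filter.Eventually.of_forall fun ξ => ?_)
  simp only [← mul_sub, norm_mul]
  rw [Complex.norm_exp]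
  simp

/-- The regularisation of `φ` with Fourier transform `φ̂ ∏ cosh (a ξ_j)⁻¹`. -/
def regularise (φ : E d → ℂ) (a : ℝ) : E d → ℂ := invFourierT (fourierT φ * sechProd d a)

lemma regularise_mem_C0 (hφ : Continuous φ) (hc : HasCompactSupport φ) {a : ℝ} (ha : 0 < a) :
    regularise φ a ∈ C0 d :=
  invFourierT_mem_C0 (mul_mem_C0 (fourierT_mem_P0_of_hasCompactSupport hφ hc) (sechProd_mem_C0 ha))

/-- Both operations are multiplications in Fourier space, so they commute; uniform approximation
then passes to derivatives. -/
lemma multiDeriv_regularise (hφ : ContDiff ℝ ∞ φ) (hc : HasCompactSupport φ) {a : ℝ} (ha : 0 < a)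
    (I : Fin d →₀ ℕ) : multiDeriv I (regularise φ a) = regularise (multiDeriv I φ) a := by
  have h := regularise_mem_C0 hφ.continuous hc ha
  rw [← invFourierT_fourierT_of_mem_C0 (multiDeriv_mem_C0 h I), fourierT_multiDeriv h, regularise,
    regularise, fourierT_invFourierT_of_mem_C0 (mul_mem_C0
      (fourierT_mem_P0_of_hasCompactSupport hφ.continuous hc) (sechProd_mem_C0 ha)),
    (multiDeriv_of_hasCompactSupport hφ hc I).2, mul_assoc]

/-- The uniform distance is controlled by the L¹ distance of the transforms, which tends to 0 by
dominated convergence with majorant 2|φ̂|. -/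
lemma eventually_norm_regularise_sub_lt (hφ : ContDiff ℝ ∞ φ) (hc : HasCompactSupport φ) {η : ℝ}
    (hη : 0 < η) : ∀ᶠ a in 𝓝[>] (0 : ℝ), ∀ x, ‖regularise φ a x - φ x‖ < η := by
  have hF := integrable_fourierT_of_hasCompactSupport hφ hc
  have hmeas : ∀ᶠ a in 𝓝[>] (0 : ℝ), AEStronglyMeasurable (sechProd d a) :=
    eventually_mem_nhdsWithin.mono fun a ha =>
      (continuous_of_mem_C0 (sechProd_mem_C0 ha)).aestronglyMeasurable
  have hlim : Filter.Tendsto (fun a => ‖((2 * Real.pi : ℝ) : ℂ)⁻¹ ^ d‖ *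
      ∫ ξ, ‖(fourierT φ * sechProd d a) ξ - fourierT φ ξ‖) (𝓝[>] 0) (𝓝 0) := by
    suffices Filter.Tendsto (fun a => ∫ ξ, ‖(fourierT φ * sechProd d a) ξ - fourierT φ ξ‖)
        (𝓝[>] 0) (𝓝 (∫ _ : E d, (0 : ℝ))) by
      have h := this.const_mul ‖((2 * Real.pi : ℝ) : ℂ)⁻¹ ^ d‖
      rwa [integral_zero, mul_zero] at h
    refine tendsto_integral_filter_of_dominated_convergence (fun ξ => 2 * ‖fourierT φ ξ‖)
      (hmeas.mono fun a ha => ((hF.1.mul ha).sub hF.1).norm)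
      (Filter.Eventually.of_forall fun a => Filter.Eventually.of_forall fun ξ => ?_)
      (hF.norm.const_mul 2) (Filter.Eventually.of_forall fun ξ => ?_)
    · rw [norm_norm, Pi.mul_apply]
      refine (norm_sub_le _ _).trans ?_
      rw [norm_mul]
      nlinarith [norm_sechProd_le_one a ξ, norm_nonneg (fourierT φ ξ)]
    · have h1 := (((tendsto_sechProd ξ).const_mul (fourierT φ ξ)).sub_const
        (fourierT φ ξ)).norm
      simpa using h1
  filter_upwards [hlim.eventually_lt_const hη, hmeas] with a ha hm x
  have h2 : φ x = invFourierT (fourierT φ) x := by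
    rw [invFourierT_fourierT hφ.continuous (hφ.continuous.integrable_of_hasCompactSupport hc) hF]
  rw [h2]
  refine (norm_invFourierT_sub_le ?_ hF x).trans_lt ha
  exact hF.mul_bdd (c := 1) hm (Filter.Eventually.of_forall fun ξ => norm_sechProd_le_one a ξ)

/-- Cut g off by a bump equal to 1 on a ball around K and regularise. Only finitely many I have
degree at most N, so one parameter a serves them all. -/
theorem C0_dense (g : E d → ℂ) (hg : ContDiff ℝ ∞ g) (K : Set (E d)) (hK : IsCompact K) (N : ℕ)
    (η : ℝ) (hη : 0 < η) : ∃ f ∈ C0 d, ∀ I : Fin d →₀ ℕ, I.degree ≤ N → ∀ x ∈ K,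
      ‖multiDeriv I f x - multiDeriv I g x‖ < η := by
  obtain ⟨R, hR, hKR⟩ := hK.isBounded.subset_ball_lt 0 0
  let χ : ContDiffBump (0 : E d) := ⟨R, R + 1, hR, by linarith⟩
  set φ : E d → ℂ := fun x => (χ x : ℂ) * g x with hφdef
  have hφ : ContDiff ℝ ∞ φ := (Complex.ofRealCLM.contDiff.comp χ.contDiff).mul hg
  have hc : HasCompactSupport φ :=
    (χ.hasCompactSupport.comp_left (g := ((↑) : ℝ → ℂ)) Complex.ofReal_zero).mul_right
  have heq : ∀ x ∈ K, φ =ᶠ[𝓝 x] g := fun x hx => by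
    filter_upwards [Metric.isOpen_ball.mem_nhds (hKR hx)] with y hy
    rw [hφdef]
    simp [χ.one_of_mem_closedBall (Metric.ball_subset_closedBall hy)]
  have hev : ∀ᶠ a in 𝓝[>] (0 : ℝ), ∀ I ∈ (Finset.range (N + 1)).biUnion (indexOfDegree d),
      ∀ x, ‖regularise (multiDeriv I φ) a x - multiDeriv I φ x‖ < η :=
    (Filter.eventually_all_finset _).2 fun I _ => eventually_norm_regularise_sub_lt
      (contDiff_multiDeriv hφ I) (multiDeriv_of_hasCompactSupport hφ hc I).1 hη
  obtain ⟨a, ha, ha0⟩ := (hev.and eventually_mem_nhdsWithin).exists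
  refine ⟨regularise φ a, regularise_mem_C0 hφ.continuous hc ha0, fun I hI x hx => ?_⟩
  rw [multiDeriv_regularise hφ hc ha0, ← (multiDeriv_congr hφ hg (heq x hx) I).eq_of_nhds]
  exact ha I (Finset.mem_biUnion.2 ⟨I.degree, Finset.mem_range.2 (by omega),
    mem_indexOfDegree.2 rfl⟩) x

end Density

/-! ### An algebraic criterion for the tensor square -/

section TensorSquare

open TensorProduct in
/-- A bilinear map for which finite families are divisible by a common regular element identifies
the tensor square with the module. -/
lemma bijective_lift_of_common_divisor {R M : Type*} [CommRing R] [AddCommGroup M] [Module R M]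
    (μ : M →ₗ[R] M →ₗ[R] M)
    (hdiv : ∀ s : Finset M, ∃ u, (∀ f ∈ s, ∃ r : R, r • u = f) ∧ Function.Injective (μ u))
    (hsurj : ∀ m, ∃ f g, μ f g = m) : Function.Bijective (TensorProduct.lift μ) := by
  classical
  constructor
  · rw [injective_iff_map_eq_zero]
    -- If u divides all left factors of t, every summand ru ⊗ g equals u ⊗ rg, so t collapses to one
    -- pure tensor. Letting u be any common divisor of a finite set s makes sums work by taking
    -- unions.
    have key : ∀ t : M ⊗[R] M, ∃ s : Finset M, ∀ u, (∀ f ∈ s, ∃ r : R, r • u = f) →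
        ∃ g, t = u ⊗ₜ[R] g := fun t => by
      induction t with
      | zero => exact ⟨∅, fun u _ => ⟨0, by simp⟩⟩
      | tmul f g =>
        refine ⟨{f}, fun u hu => ?_⟩
        obtain ⟨r, rfl⟩ := hu f (by simp)
        exact ⟨r • g, TensorProduct.smul_tmul _ _ _⟩
      | add x y hx hy =>
        obtain ⟨s, hs⟩ := hx
        obtain ⟨s', hs'⟩ := hy
        refine ⟨s ∪ s', fun u hu => ?_⟩
        obtain ⟨g, rfl⟩ := hs u fun f hf => hu f (Finset.mem_union_left _ hf)
        obtain ⟨g', rfl⟩ := hs' u fun f hf => hu f (Finset.mem_union_right _ hf)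
        exact ⟨g + g', (TensorProduct.tmul_add _ _ _).symm⟩
    intro t ht
    obtain ⟨s, hs⟩ := key t
    obtain ⟨u, hu, hinj⟩ := hdiv s
    obtain ⟨g, rfl⟩ := hs u hu
    rw [TensorProduct.lift.tmul] at ht
    rw [(injective_iff_map_eq_zero (μ u)).1 hinj g ht, TensorProduct.tmul_zero]
  · intro m
    obtain ⟨f, g, rfl⟩ := hsurj m
    exact ⟨f ⊗ₜ g, TensorProduct.lift.tmul _ _⟩

end TensorSquare

/-! ### The convenient analytical setting -/

section Setting

/-- The function space as a non-unital algebra. -/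
def funcs (d : ℕ) : NonUnitalSubalgebra ℂ (E d → ℂ) where
  carrier := C0 d
  add_mem' := add_mem_C0
  zero_mem' := zero_mem_C0
  mul_mem' hf hg := mul_mem_C0 (C0_subset_P0 hf) hg
  smul_mem' c _ hf := smul_mem_C0 c hf

/-- The ring of operators. -/
abbrev ops (d : ℕ) : Subring (MvPowerSeries (Fin d) ℂ) := (symbolHom d).range

/-- The ring of operators is the ring of symbols. -/
def opEquiv (d : ℕ) : symbolRing d ≃+* ops d :=
  RingEquiv.ofBijective (symbolHom d).rangeRestrict
    ⟨fun _ _ h => symbolHom_injective (congrArg Subtype.val h), (symbolHom d).rangeRestrict_surjective⟩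

/-- The symbol of an operator. -/
def symbol (P : ops d) : symbolRing d := (opEquiv d).symm P

lemma symbolSeries_symbol (P : ops d) : symbolSeries (symbol P : E d → ℂ) = P :=
  congrArg Subtype.val ((opEquiv d).apply_symm_apply P)

lemma symbol_eq {P : ops d} {p : symbolRing d} (h : (P : MvPowerSeries (Fin d) ℂ) = symbolHom d p) :
    symbol P = p :=
  symbolHom_injective ((symbolSeries_symbol P).trans h)

lemma funcs_ext {f g : funcs d} (h : fourierT (f : E d → ℂ) = fourierT (g : E d → ℂ)) : f = g :=
  Subtype.ext (fourierT_injOn_C0 f.2 g.2 h)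

/-- The function with a given Fourier transform. -/
def ofFourier (g : E d → ℂ) (hg : g ∈ C0 d) : funcs d := ⟨invFourierT g, invFourierT_mem_C0 hg⟩

@[simp] lemma fourierT_ofFourier (g : E d → ℂ) (hg : g ∈ C0 d) :
    fourierT (ofFourier g hg : E d → ℂ) = g := fourierT_invFourierT_of_mem_C0 hg

lemma fourierT_funcs_add (f g : funcs d) :
    fourierT ((f + g : funcs d) : E d → ℂ) = fourierT (f : E d → ℂ) + fourierT (g : E d → ℂ) :=
  fourierT_add (integrable_of_mem_C0 f.2) (integrable_of_mem_C0 g.2)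

lemma fourierT_funcs_smul (c : ℂ) (f : funcs d) :
    fourierT ((c • f : funcs d) : E d → ℂ) = c • fourierT (f : E d → ℂ) :=
  fourierT_smul c (f : E d → ℂ)

lemma fourierT_funcs_zero : fourierT ((0 : funcs d) : E d → ℂ) = 0 := by
  ext ξ
  simp [fourierT]

/-- The module laws are checked on Fourier transforms, which determine the functions by `funcs_ext`.
-/
instance : SMul (ops d) (funcs d) where
  smul P f := ofFourier ((symbol P : E d → ℂ) * fourierT (f : E d → ℂ))
    (mul_mem_C0 (symbol P).2 (fourierT_mem_C0 f.2))

lemma coe_ops_smul (P : ops d) (f : funcs d) :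
    ((P • f : funcs d) : E d → ℂ) = pseudoDiff (symbol P : E d → ℂ) f := rfl

lemma fourierT_ops_smul (P : ops d) (f : funcs d) :
    fourierT ((P • f : funcs d) : E d → ℂ) = (symbol P : E d → ℂ) * fourierT (f : E d → ℂ) :=
  fourierT_ofFourier _ _

instance opsModule : Module (ops d) (funcs d) where
  one_smul f := funcs_ext (by simp [fourierT_ops_smul, symbol])
  mul_smul P Q f := funcs_ext (by simp [fourierT_ops_smul, symbol, mul_assoc])
  smul_zero P := funcs_ext (by rw [fourierT_ops_smul, fourierT_funcs_zero, mul_zero])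
  smul_add P f g := funcs_ext (by simp only [fourierT_ops_smul, fourierT_funcs_add, mul_add])
  add_smul P Q f := funcs_ext (by
    simp only [fourierT_ops_smul, fourierT_funcs_add, symbol, map_add, Subring.coe_add, add_mul])
  zero_smul f := funcs_ext (by rw [fourierT_ops_smul, fourierT_funcs_zero]; simp [symbol])

lemma polySymbol_map (q : MvPolynomial (Fin d) ℝ) :
    polySymbol d (MvPolynomial.map (algebraMap ℝ ℂ) q) =
      ∑ I ∈ q.support, constSymbol d (MvPolynomial.coeff I q : ℝ) * monoSymbol I := by
  rw [polySymbol, MvPolynomial.coe_eval₂Hom, MvPolynomial.eval₂_map, MvPolynomial.eval₂_eq']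
  rfl

lemma fourierT_sum {ι : Type*} (s : Finset ι) (f : ι → E d → ℂ) (hf : ∀ i ∈ s, f i ∈ C0 d) :
    (∑ i ∈ s, f i) ∈ C0 d ∧ fourierT (∑ i ∈ s, f i) = ∑ i ∈ s, fourierT (f i) := by
  classical
  induction s using Finset.induction_on with
  | empty => exact ⟨zero_mem_C0, fourierT_funcs_zero⟩
  | insert i s his ih =>
    obtain ⟨h1, h2⟩ := ih fun j hj => hf j (Finset.mem_insert_of_mem hj)
    have h3 := hf i (Finset.mem_insert_self _ _)
    rw [Finset.sum_insert his, Finset.sum_insert his, ← h2]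
    exact ⟨add_mem_C0 h3 h1, fourierT_add (integrable_of_mem_C0 h3) (integrable_of_mem_C0 h1)⟩

lemma poly_smul (q : MvPolynomial (Fin d) ℝ) (P : ops d)
    (hP : (P : MvPowerSeries (Fin d) ℂ) = polySeries q) (f : funcs d) :
    ((P • f : funcs d) : E d → ℂ) =
      ∑ I ∈ q.support, ((MvPolynomial.coeff I q : ℝ) : ℂ) • multiDeriv I (f : E d → ℂ) := by
  obtain ⟨h1, h2⟩ := fourierT_sum q.support
    (fun I => ((MvPolynomial.coeff I q : ℝ) : ℂ) • multiDeriv I (f : E d → ℂ))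
    fun I _ => smul_mem_C0 _ (multiDeriv_mem_C0 f.2 I)
  refine fourierT_injOn_C0 (P • f : funcs d).2 h1 ?_
  rw [h2, fourierT_ops_smul, symbol_eq (hP.trans (symbolHom_polySymbol _).symm), polySymbol_map]
  ext ξ
  simp only [fourierT_smul, fourierT_multiDeriv f.2, Pi.mul_apply, Finset.sum_apply,
    Pi.smul_apply, smul_eq_mul, AddSubmonoidClass.coe_finsetSum, Finset.sum_mul]
  exact Finset.sum_congr rfl fun I _ => mul_assoc _ _ _

lemma ops_smul_hasSum (P : ops d) : ∃ U ∈ 𝓝 (0 : E d), ∀ f : funcs d, ∀ ξ ∈ U,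
    HasSum (fun I : Fin d →₀ ℕ => MvPowerSeries.coeff I (P : MvPowerSeries (Fin d) ℂ) *
      fourierT (multiDeriv I (f : E d → ℂ)) ξ) (fourierT ((P • f : funcs d) : E d → ℂ) ξ) := by
  obtain ⟨U, hU, h⟩ := hasSum_symbolSeries (symbol P).2
  refine ⟨U, hU, fun f ξ hξ => ?_⟩
  rw [fourierT_ops_smul, Pi.mul_apply]
  refine ((h ξ hξ).mul_right (fourierT (f : E d → ℂ) ξ)).congr_fun fun I => ?_
  rw [fourierT_multiDeriv f.2, symbolSeries_symbol, Pi.mul_apply, mul_assoc]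

lemma fourierT_multiDeriv_mul (f g : funcs d) (J : Fin d →₀ ℕ) (ξ : E d) :
    fourierT (multiDeriv J ((f * g : funcs d) : E d → ℂ)) ξ =
      ∑ I ∈ Finset.HasAntidiagonal.antidiagonal J, (multiChoose (I.1 + I.2) I.1 : ℂ) *
        fourierT (multiDeriv I.1 (f : E d → ℂ) * multiDeriv I.2 (g : E d → ℂ)) ξ := by
  have h1 : multiDeriv J ((f * g : funcs d) : E d → ℂ) = _ :=
    multiDeriv_mul (contDiff_of_mem_C0 f.2) (contDiff_of_mem_C0 g.2) J
  rw [h1, (fourierT_sum _ _ fun I _ => smul_mem_C0 _ (mul_mem_C0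
    (C0_subset_P0 (multiDeriv_mem_C0 f.2 I.1)) (multiDeriv_mem_C0 g.2 I.2))).2, Finset.sum_apply]
  simp only [fourierT_smul, Pi.smul_apply, smul_eq_mul]

lemma fourierT_mul_fourierT_mem_C0 (f g : funcs d) :
    fourierT (f : E d → ℂ) * fourierT (g : E d → ℂ) ∈ C0 d :=
  mul_mem_C0 (C0_subset_P0 (fourierT_mem_C0 f.2)) (fourierT_mem_C0 g.2)

/-- Convolution as a bilinear map. -/
def conv (d : ℕ) : funcs d →ₗ[ops d] funcs d →ₗ[ops d] funcs d :=
  LinearMap.mk₂ (ops d)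
    (fun f g => ofFourier _ (fourierT_mul_fourierT_mem_C0 f g))
    (fun f g h => funcs_ext (by simp only [fourierT_ofFourier, fourierT_funcs_add, add_mul]))
    (fun P f g => funcs_ext (by simp [fourierT_ops_smul, mul_assoc]))
    (fun f g h => funcs_ext (by simp only [fourierT_ofFourier, fourierT_funcs_add, mul_add]))
    (fun P f g => funcs_ext (by simp [fourierT_ops_smul, mul_left_comm]))

lemma fourierT_conv (f g : funcs d) :
    fourierT (conv d f g : E d → ℂ) = fourierT (f : E d → ℂ) * fourierT (g : E d → ℂ) :=
  fourierT_ofFourier _ (fourierT_mul_fourierT_mem_C0 f g)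

lemma coe_conv (f g : funcs d) : (conv d f g : E d → ℂ) =
    convolution (f : E d → ℂ) (g : E d → ℂ) (ContinuousLinearMap.mul ℂ ℂ) volume :=
  (convolution_eq_invFourierT f.2 g.2).symm

lemma exists_common_sechProd (s : Finset (funcs d)) :
    ∃ a > 0, ∀ f ∈ s, (sechProd d a)⁻¹ * fourierT (f : E d → ℂ) ∈ C0 d := by
  -- Strengthened to all smaller parameters, so that the induction can pass to a minimum.
  suffices ∃ a₀ > 0, ∀ a, 0 < a → a ≤ a₀ →
      ∀ f ∈ s, (sechProd d a)⁻¹ * fourierT (f : E d → ℂ) ∈ C0 d by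
    obtain ⟨a₀, h0, h⟩ := this
    exact ⟨a₀, h0, h a₀ h0 le_rfl⟩
  classical
  induction s using Finset.induction_on with
  | empty => exact ⟨1, one_pos, by simp⟩
  | insert f s _ ih =>
    obtain ⟨a₁, h1, h1'⟩ := ih
    obtain ⟨a₂, h2, h2'⟩ := exists_div_sechProd (fourierT_mem_C0 f.2)
    refine ⟨min a₁ a₂, lt_min h1 h2, fun a ha ha' g hg => ?_⟩
    rcases Finset.mem_insert.1 hg with rfl | hg
    · exact h2' a ha (ha'.trans (min_le_right _ _))
    · exact h1' a ha (ha'.trans (min_le_left _ _)) g hg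

lemma sechProd_mul_inv_mul {a : ℝ} (ha : 0 < a) (h : E d → ℂ) :
    sechProd d a * ((sechProd d a)⁻¹ * h) = h := by
  ext x
  exact mul_inv_cancel_left₀ (sechProd_ne_zero ha x) (h x)

/-- The common divisor u has transform `sechProd d a`. The quotients lie in `C0` ⊆ `P0`, hence are
symbols of operators taking u to the given functions, and convolution with u is injective because
its transform has no zeros. -/
lemma conv_bijective : Function.Bijective (TensorProduct.lift (conv d)) := by
  refine bijective_lift_of_common_divisor (conv d) (fun s => ?_) fun m => ?_
  · obtain ⟨a, ha, h⟩ := exists_common_sechProd s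
    refine ⟨ofFourier (sechProd d a) (sechProd_mem_C0 ha), fun f hf => ?_, fun f g hfg => ?_⟩
    · refine ⟨opEquiv d ⟨_, C0_subset_P0 (h f hf)⟩, funcs_ext ?_⟩
      rw [fourierT_ops_smul, symbol, RingEquiv.symm_apply_apply, fourierT_ofFourier, mul_comm,
        sechProd_mul_inv_mul ha]
    · have h1 := congrArg (fun f : funcs d => fourierT (f : E d → ℂ)) hfg
      simp only [fourierT_conv, fourierT_ofFourier] at h1
      refine funcs_ext (funext fun ξ => mul_left_cancel₀ (sechProd_ne_zero ha ξ) (congrFun h1 ξ))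
  · obtain ⟨a, ha, h⟩ := exists_common_sechProd {m}
    refine ⟨ofFourier (sechProd d a) (sechProd_mem_C0 ha), ofFourier _ (h m (by simp)),
      funcs_ext ?_⟩
    rw [fourierT_conv, fourierT_ofFourier, fourierT_ofFourier, sechProd_mul_inv_mul ha]

/-- The pseudo-differential operators acting on the functions with exponential decay form a
convenient analytical setting. -/
def setting (d : ℕ) : ConvenientAnalyticalSetting d where
  funcs := funcs d
  smooth _ hf := contDiff_of_mem_C0 hf
  integrable _ hf := integrable_of_mem_C0 hf
  ops := ops d
  poly_mem _ := ⟨_, symbolHom_polySymbol _⟩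
  module := opsModule
  linear P c f := funcs_ext (by
    simp only [fourierT_ops_smul, fourierT_funcs_smul, mul_smul_comm])
  poly_act q f x := by
    rw [poly_smul q _ rfl f, Finset.sum_apply]
    rfl
  act_hasSum := ops_smul_hasSum
  leibniz P := by
    obtain ⟨U, hU, h⟩ := ops_smul_hasSum P
    -- The rule is the expansion of P applied to fg, with each ∂_J(fg) expanded by the ordinary
    -- Leibniz rule; this is why terms are grouped by J.
    refine ⟨U, hU, fun f g ξ hξ => (h (f * g) ξ hξ).congr_fun fun J => ?_⟩
    rw [fourierT_multiDeriv_mul, Finset.mul_sum]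
    refine Finset.sum_congr rfl fun I hI => ?_
    rw [Finset.HasAntidiagonal.mem_antidiagonal.1 hI]
    ring
  tensor := ⟨LinearEquiv.ofBijective (TensorProduct.lift (conv d)) conv_bijective, fun f g =>
    ⟨convolutionExists_of_mem_C0 f.2 g.2, coe_conv f g⟩⟩
  dense := C0_dense

end Setting

end ConvAn

end

/-! ### The main theorem -/

theorem mainTheorem10 (d : ℕ) :
    ∃ S : ConvAn.ConvenientAnalyticalSetting d,
      (S.funcs : Set (ConvAn.E d → ℂ)) = ConvAn.funcSpace d ∧
      (S.ops : Set (MvPowerSeries (Fin d) ℂ)) = ConvAn.opRing d ∧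
      ∀ p ∈ ConvAn.P0 d, ∀ P : S.ops,
        (P : MvPowerSeries (Fin d) ℂ) = ConvAn.symbolSeries p →
          ∀ f : S.funcs,
            ((P • f : S.funcs) : ConvAn.E d → ℂ) = ConvAn.pseudoDiff p (f : ConvAn.E d → ℂ) := by
  refine ⟨ConvAn.setting d, ConvAn.funcSpace_eq_C0.symm, ConvAn.opRing_eq.symm,
    fun p hp P hP f => ?_⟩
  have h : ConvAn.symbol P = ⟨p, hp⟩ := ConvAn.symbol_eq hP
  exact (ConvAn.coe_ops_smul P f).trans (by rw [h])
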